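/- Let $\mathcal D=\{[j2^k,(j+1)2^k): j,k\in\mathbb Z\}$ be the dyadic intervals of $\mathbb R$. For $I\in\mathcal D$ with left and right halves $I_-,I_+$ let $h_I=|I|^{-1/2}(-\mathbf 1_{I_-}+\mathbf 1_{I_+})$ be its Haar function, and for a locally integrable (real- or complex-valued) function $b$ on $\mathbb R$ define the dyadic BMO seminorm $$\|b\|_{\mathrm{BMO}}=\sup_{J\in\mathcal D}\Bigl[\frac1{|J|}\sum_{I\in\mathcal D,\ I\subseteq J}|\langle b,h_I\rangle|^2\Bigr]^{1/2}\in[0,\infty].$$ For $0<\alpha<1$ let $$\operatorname I_\alpha f=\sum_{I\in\mathcal D}\frac{\langle f,\mathbf 1_I\rangle}{|I|^{\alpha}}\mathbf 1_I$$ be the dyadic Riesz potential, which we call well defined at a measurable $f$ if $\sum_{I\in\mathcal D}|I|^{-\alpha}\langle |f|,\mathbf 1_I\rangle\mathbf 1_I<\infty$ almost everywhere. Let $\operatorname M_bf=bf$ and $[\operatorname M_b,\operatorname I_\alpha]f=b\,\operatorname I_\alpha f-\operatorname I_\alpha(bf)$. Let $\|[\operatorname M_b,\operatorname I_\alpha]\|_{p\to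 q}\in[0,\infty]$ be the least $C$ with $\|[\operatorname M_b,\operatorname I_\alpha]f\|_{L^q}\le C\|f\|_{L^p}$ for all $f\in L^p(\mathbb R)$ for which $\operatorname I_\alpha f$ and $\operatorname I_\alpha(bf)$ are well defined. **Theorem.** Let $0<\alpha<1$ and $1<p<q<\infty$ with $1-\alpha+\frac1q=\frac1p$. There are constants $c,C\in(0,\infty)$ depending only on $\alpha,p,q$ such that for every locally integrable $b$ on $\mathbb R$ $$c\,\|b\|_{\mathrm{BMO}}\le\|[\operatorname M_b,\operatorname I_\alpha]\|_{p\to q}\le C\,\|b\|_{\mathrm{BMO}}.$$ Moreover, if $\|b\|_{\mathrm{BMO}}<\infty$, then $\operatorname I_\alpha f$ and $\operatorname I_\alpha(bf)$ are well defined for every $f\in L^p(\mathbb R)$, so that $[\operatorname M_b,\operatorname I_\alpha]$ is defined on all of $L^p(\mathbb R)$. -/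

import Mathlib

open MeasureTheory
open scoped ENNReal NNReal

noncomputable section

namespace DyadicChanillo

variable {𝕜 : Type*} [RCLike 𝕜]

/-- The dyadic interval `[j 2^k, (j+1) 2^k)` with index `I = (j, k)`. Distinct indices give
distinct intervals, so the collection of all dyadic intervals is indexed by `ℤ × ℤ`. -/
def dyadic (I : ℤ × ℤ) : Set ℝ :=
  Set.Ico ((I.1 : ℝ) * (2 : ℝ) ^ I.2) (((I.1 : ℝ) + 1) * (2 : ℝ) ^ I.2)

/-- The length `|I| = 2^k` of the dyadic interval with index `I = (j, k)`. -/
def len (I : ℤ × ℤ) : ℝ := (2 : ℝ) ^ I.2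

/-- Index of the left half of a dyadic interval. -/
def leftHalf (I : ℤ × ℤ) : ℤ × ℤ := (2 * I.1, I.2 - 1)

/-- Index of the right half of a dyadic interval. -/
def rightHalf (I : ℤ × ℤ) : ℤ × ℤ := (2 * I.1 + 1, I.2 - 1)

/-- The Haar function `h_I = |I|^(-1/2) (-1_{I_-} + 1_{I_+})`. -/
def haar (I : ℤ × ℤ) (x : ℝ) : ℝ :=
  len I ^ (-(1 / 2) : ℝ) *
    (-(dyadic (leftHalf I)).indicator 1 x + (dyadic (rightHalf I)).indicator 1 x)

/-- The Haar coefficient `⟨f, h_I⟩`. -/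
def haarCoeff (f : ℝ → 𝕜) (I : ℤ × ℤ) : 𝕜 := ∫ x, haar I x • f x

/-- The dyadic BMO seminorm `sup_J (|J|⁻¹ ∑_{I ⊆ J} |⟨b, h_I⟩|²)^(1/2)`, with values in `[0, ∞]`. -/
def bmoNorm (b : ℝ → 𝕜) : ℝ≥0∞ :=
  ⨆ J : ℤ × ℤ,
    ((ENNReal.ofReal (len J))⁻¹ *
      ∑' I : {I : ℤ × ℤ // dyadic I ⊆ dyadic J}, ‖haarCoeff b I.1‖ₑ ^ 2) ^ (1 / 2 : ℝ)

/-- The dyadic Riesz potential `I_α f = ∑_I |I|^(-α) ⟨f, 1_I⟩ 1_I`, as a pointwise series. -/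
def riesz (α : ℝ) (f : ℝ → 𝕜) (x : ℝ) : 𝕜 :=
  ∑' I : ℤ × ℤ, (dyadic I).indicator (fun _ => len I ^ (-α) • ∫ y in dyadic I, f y) x

/-- The dyadic Riesz potential of `f` is well defined: at almost every point the series
`∑_I |I|^(-α) ⟨|f|, 1_I⟩ 1_I` is finite. In particular `f` is then integrable on every dyadic
interval, and the series defining `riesz α f` converges absolutely almost everywhere. -/
def RieszDefined (α : ℝ) (f : ℝ → 𝕜) : Prop :=
  AEStronglyMeasurable f volume ∧
    ∀ᵐ x : ℝ, ∑' I : ℤ × ℤ, (dyadic I).indicator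
      (fun _ => ENNReal.ofReal (len I ^ (-α)) * ∫⁻ y in dyadic I, ‖f y‖ₑ) x < ∞

/-- The operator `M_b` of pointwise multiplication by `b`. -/
def mulOp (b f : ℝ → 𝕜) : ℝ → 𝕜 := fun x => b x * f x

/-- The commutator `[A, B] = A B - B A` of two operators on functions. -/
def commutator (A B : (ℝ → 𝕜) → ℝ → 𝕜) (f : ℝ → 𝕜) : ℝ → 𝕜 := fun x => A (B f) x - B (A f) x

/-- The natural domain in `L^p` of `[M_b, I_α]`: the `f ∈ L^p` for which both `I_α f` and
`I_α (b f)` are well defined. For locally integrable `b` it contains all bounded compactly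
supported functions, hence is dense in `L^p` for `p < ∞`. -/
def CommDomain (α p : ℝ) (b f : ℝ → 𝕜) : Prop :=
  MemLp f (ENNReal.ofReal p) volume ∧ RieszDefined α f ∧ RieszDefined α (mulOp b f)

/-- The `L^p → L^q` norm of `[M_b, I_α]`, with values in `[0, ∞]`: the least `C` such that
`‖[M_b, I_α] f‖_q ≤ C ‖f‖_p` for all `f` in the natural domain. -/
def commNorm (α p q : ℝ) (b : ℝ → 𝕜) : ℝ≥0∞ :=
  sInf {C : ℝ≥0∞ | ∀ f : ℝ → 𝕜, CommDomain α p b f →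
    eLpNorm (commutator (mulOp b) (riesz α) f) (ENNReal.ofReal q) volume
      ≤ C * eLpNorm f (ENNReal.ofReal p) volume}

end DyadicChanillo

end

noncomputable section

namespace DyadicChanillo

variable {𝕜 : Type*} [RCLike 𝕜]

/-! Upper bound. The commutator has kernel (b(x) - b(y)) ∑_I |I|^(-α) 1_I(x) 1_I(y). Inserting the
average b_I dominates it pointwise by two positive operators, in which the weight |b - b_I| stands
inside or outside the integral over I (`enorm_commutator_le`). By John–Nirenberg
(`lintegral_norm_sub_avg_pow_le`) these weights have L^s averages on I of size at most a constant
times the BMO norm, for integers s as large as desired. With t = s' close to 1, Hölder replaces the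
inner weight by that norm times ⟨|f|^t⟩_I^(1/t). The sum over scales is then Hedberg's argument
(`hedberg`): small scales are controlled by a maximal function, large ones by the L^p norm, and the
maximal theorem (`lintegral_maximal_le`) concludes. The operator with the outer weight is the
transpose, bounded by the same estimate at the dual exponents (`fracSum_weight_bound`).

John–Nirenberg and the maximal theorem are both proved by Bellman functions: an expression in the
data of an interval that dominates the wanted quantity and whose mean over the two halves does not
exceed its value on the interval.

Lower bound. On J × J', with J' the sibling of J, the kernel of I_α is a constant ρ ≥ |J|^(-α)/2
(`riesz_of_support`). If p ≤ 2, test on f = ∑ conj⟨b, h_I⟩ h_I over finitely many I ⊆ J: on J' the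
term b I_α f vanishes because f has mean zero, and the other term is ρ ∑ |⟨b, h_I⟩|² up to sign. If
q ≥ 2, test on 1_{J'}: on J the commutator is ρ |J| (b - b_{J'}), and pairing with the same f
recovers the sum. Since p < q, one of the two cases always applies. -/

/-! ### Geometry of the dyadic intervals -/

/-- Index of the dyadic interval of length `2^k` that contains `x`. -/
def idx (k : ℤ) (x : ℝ) : ℤ × ℤ := (⌊x / (2 : ℝ) ^ k⌋, k)

@[simp] lemma idx_snd (k : ℤ) (x : ℝ) : (idx k x).2 = k := rfl

lemma len_pos (I : ℤ × ℤ) : 0 < len I := zpow_pos (by norm_num) _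

/-- Membership becomes an equation between indices, so nesting and disjointness reduce to rewriting.
-/
lemma mem_dyadic_iff {I : ℤ × ℤ} {x : ℝ} : x ∈ dyadic I ↔ idx I.2 x = I := by
  have h : (0 : ℝ) < 2 ^ I.2 := zpow_pos (by norm_num) _
  rw [Prod.ext_iff]
  simp only [dyadic, Set.mem_Ico, idx, and_true, Int.floor_eq_iff]
  rw [le_div_iff₀ h, div_lt_iff₀ h]

lemma mem_dyadic_idx (k : ℤ) (x : ℝ) : x ∈ dyadic (idx k x) :=
  mem_dyadic_iff.2 rfl

lemma measurableSet_dyadic (I : ℤ × ℤ) : MeasurableSet (dyadic I) := measurableSet_Ico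

lemma dyadic_eq_Ico (I : ℤ × ℤ) :
    dyadic I = Set.Ico ((I.1 : ℝ) * len I) ((I.1 : ℝ) * len I + len I) := by
  simp only [dyadic, len, add_mul, one_mul]

lemma volume_dyadic (I : ℤ × ℤ) : volume (dyadic I) = ENNReal.ofReal (len I) := by
  rw [dyadic_eq_Ico, Real.volume_Ico]; congr 1; ring

lemma volume_real_dyadic (I : ℤ × ℤ) : volume.real (dyadic I) = len I := by
  rw [Measure.real, volume_dyadic, ENNReal.toReal_ofReal (len_pos I).le]

lemma volume_dyadic_ne_top (I : ℤ × ℤ) : volume (dyadic I) ≠ ∞ := by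
  simp [volume_dyadic]

lemma nonempty_dyadic (I : ℤ × ℤ) : (dyadic I).Nonempty := by
  rw [dyadic_eq_Ico]; exact Set.nonempty_Ico.2 (by linarith [len_pos I])

lemma len_leftHalf (I : ℤ × ℤ) : len (leftHalf I) = len I / 2 := by
  simp [len, leftHalf, zpow_sub₀]

lemma len_rightHalf (I : ℤ × ℤ) : len (rightHalf I) = len I / 2 := by
  simp [len, rightHalf, zpow_sub₀]

lemma dyadic_leftHalf (I : ℤ × ℤ) :
    dyadic (leftHalf I) = Set.Ico ((I.1 : ℝ) * len I) ((I.1 : ℝ) * len I + len I / 2) := by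
  rw [dyadic_eq_Ico, len_leftHalf]
  congr 1 <;> simp only [leftHalf] <;> push_cast <;> ring

lemma dyadic_rightHalf (I : ℤ × ℤ) :
    dyadic (rightHalf I) =
      Set.Ico ((I.1 : ℝ) * len I + len I / 2) ((I.1 : ℝ) * len I + len I) := by
  rw [dyadic_eq_Ico, len_rightHalf]
  congr 1 <;> simp only [rightHalf] <;> push_cast <;> ring

lemma dyadic_halves_union (I : ℤ × ℤ) :
    dyadic (leftHalf I) ∪ dyadic (rightHalf I) = dyadic I := by
  have := len_pos I
  rw [dyadic_leftHalf, dyadic_rightHalf, dyadic_eq_Ico, Set.Ico_union_Ico_eq_Ico] <;> linarith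

lemma disjoint_halves (I : ℤ × ℤ) :
    Disjoint (dyadic (leftHalf I)) (dyadic (rightHalf I)) := by
  rw [dyadic_leftHalf, dyadic_rightHalf]
  exact Set.Ico_disjoint_Ico_same

lemma dyadic_leftHalf_subset (I : ℤ × ℤ) : dyadic (leftHalf I) ⊆ dyadic I := by
  rw [← dyadic_halves_union I]; exact Set.subset_union_left

lemma dyadic_rightHalf_subset (I : ℤ × ℤ) : dyadic (rightHalf I) ⊆ dyadic I := by
  rw [← dyadic_halves_union I]; exact Set.subset_union_right

lemma disjoint_dyadic_of_ne {I K : ℤ × ℤ} (h : I.2 = K.2) (hne : I ≠ K) :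
    Disjoint (dyadic I) (dyadic K) := by
  rw [Set.disjoint_left]
  intro x hI hK
  rw [mem_dyadic_iff] at hI hK
  exact hne (by rw [← hI, ← hK, h])

/-- The index of the level-`m` ancestor, `k ≤ m`, depends only on the index at level `k`. -/
lemma idx_ancestor {k m : ℤ} (h : k ≤ m) {x y : ℝ} (hxy : idx k x = idx k y) :
    idx m x = idx m y := by
  obtain ⟨n, rfl⟩ := Int.le.dest h
  -- Passing to the ancestor n levels up is integer division of the position by 2^n.
  have key : ∀ z : ℝ, ⌊z / (2 : ℝ) ^ (k + n)⌋ = ⌊z / (2 : ℝ) ^ k⌋ / (2 ^ n : ℕ) := by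
    intro z
    rw [zpow_add₀ (by norm_num), ← div_div, ← Int.floor_div_natCast]
    push_cast; simp
  simp only [idx, Prod.mk.injEq, and_true] at hxy ⊢
  rw [key, key, hxy]

lemma dyadic_subset_of_mem {I K : ℤ × ℤ} (h : I.2 ≤ K.2) {x : ℝ} (hI : x ∈ dyadic I)
    (hK : x ∈ dyadic K) : dyadic I ⊆ dyadic K := by
  intro y hy
  rw [mem_dyadic_iff] at *
  rw [← hK]
  exact idx_ancestor h (by rw [hy, hI])

lemma len_le_of_subset {I K : ℤ × ℤ} (h : dyadic I ⊆ dyadic K) : len I ≤ len K := by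
  have := measure_mono (μ := volume) h
  rwa [volume_dyadic, volume_dyadic, ENNReal.ofReal_le_ofReal_iff (len_pos K).le] at this

lemma level_le_of_subset {I K : ℤ × ℤ} (h : dyadic I ⊆ dyadic K) : I.2 ≤ K.2 :=
  (zpow_le_zpow_iff_right₀ (by norm_num : (1 : ℝ) < 2)).1 (len_le_of_subset h)

lemma idx_injective (x : ℝ) : Function.Injective (fun k => idx k x) :=
  fun _ _ h => congrArg Prod.snd h

/-- Each point lies in exactly one interval per level, so a series over all dyadic intervals is
pointwise a series over scales. -/
lemma tsum_indicator_dyadic {M : Type*} [AddCommMonoid M] [TopologicalSpace M]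
    (a : ℤ × ℤ → M) (x : ℝ) :
    ∑' I : ℤ × ℤ, (dyadic I).indicator (fun _ => a I) x = ∑' k : ℤ, a (idx k x) := by
  rw [← (idx_injective x).tsum_eq]
  · refine tsum_congr fun k => ?_
    rw [Set.indicator_of_mem (mem_dyadic_idx k x)]
  · intro I hI
    have : x ∈ dyadic I := by
      by_contra hx
      exact hI (Set.indicator_of_notMem hx _)
    exact ⟨I.2, mem_dyadic_iff.1 this⟩

lemma measurable_idx (k : ℤ) : Measurable (idx k) := by
  unfold idx
  exact (Int.measurable_floor.comp (measurable_id.div_const _)).prodMk measurable_const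

lemma setLIntegral_halves (I : ℤ × ℤ) (f : ℝ → ℝ≥0∞) :
    ∫⁻ x in dyadic I, f x =
      (∫⁻ x in dyadic (leftHalf I), f x) + ∫⁻ x in dyadic (rightHalf I), f x := by
  rw [← dyadic_halves_union I,
    lintegral_union (measurableSet_dyadic _) (disjoint_halves I)]

/-- Integration over `ℝ` as a sum over the dyadic intervals of a fixed length. -/
lemma lintegral_eq_tsum_level (k : ℤ) (f : ℝ → ℝ≥0∞) :
    ∫⁻ x, f x = ∑' j : ℤ, ∫⁻ x in dyadic (j, k), f x := by
  rw [← setLIntegral_univ, ← lintegral_iUnion (fun j => measurableSet_dyadic _)]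
  · congr 2
    ext x
    simp only [Set.mem_univ, Set.mem_iUnion, true_iff]
    exact ⟨⌊x / (2 : ℝ) ^ k⌋, mem_dyadic_idx k x⟩
  · intro i j hij
    exact disjoint_dyadic_of_ne rfl (fun h => hij (congrArg Prod.fst h))

lemma integrableOn_dyadic {E : Type*} [NormedAddCommGroup E] {b : ℝ → E}
    (hb : LocallyIntegrable b volume) (I : ℤ × ℤ) : IntegrableOn b (dyadic I) volume := by
  rw [dyadic_eq_Ico]
  exact (hb.integrableOn_isCompact isCompact_Icc).mono_set Set.Ico_subset_Icc_self

/-- The average of `b` over a dyadic interval. -/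
def avg {E : Type*} [NormedAddCommGroup E] [NormedSpace ℝ E] (b : ℝ → E) (I : ℤ × ℤ) : E :=
  (len I)⁻¹ • ∫ x in dyadic I, b x

lemma integral_halves {E : Type*} [NormedAddCommGroup E] [NormedSpace ℝ E] {b : ℝ → E}
    (hb : LocallyIntegrable b volume) (I : ℤ × ℤ) :
    ∫ x in dyadic I, b x =
      (∫ x in dyadic (leftHalf I), b x) + ∫ x in dyadic (rightHalf I), b x := by
  rw [← dyadic_halves_union I, setIntegral_union (disjoint_halves I) (measurableSet_dyadic _)
    (integrableOn_dyadic hb _) (integrableOn_dyadic hb _)]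

lemma len_smul_avg {E : Type*} [NormedAddCommGroup E] [NormedSpace ℝ E] (b : ℝ → E)
    (I : ℤ × ℤ) : len I • avg b I = ∫ x in dyadic I, b x := by
  rw [avg, smul_smul, mul_inv_cancel₀ (len_pos I).ne', one_smul]

lemma haar_smul {E : Type*} [AddCommGroup E] [Module ℝ E] (I : ℤ × ℤ) (g : ℝ → E) (x : ℝ) :
    haar I x • g x = len I ^ (-(1 / 2) : ℝ) •
      ((dyadic (rightHalf I)).indicator g x - (dyadic (leftHalf I)).indicator g x) := by
  rw [haar, mul_smul]
  congr 1
  by_cases h1 : x ∈ dyadic (leftHalf I)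
  · have h2 := Set.disjoint_left.1 (disjoint_halves I) h1
    simp [h1, h2]
  · by_cases h2 : x ∈ dyadic (rightHalf I) <;> simp [h1, h2]

lemma integrable_haar_smul {E : Type*} [NormedAddCommGroup E] [NormedSpace ℝ E] {b : ℝ → E}
    (hb : LocallyIntegrable b volume) (I : ℤ × ℤ) : Integrable (fun x => haar I x • b x) volume := by
  simp only [haar_smul]
  exact (((integrableOn_dyadic hb _).integrable_indicator (measurableSet_dyadic _)).sub
    ((integrableOn_dyadic hb _).integrable_indicator (measurableSet_dyadic _))).smul _

lemma haarCoeff_eq {b : ℝ → 𝕜} (hb : LocallyIntegrable b volume) (I : ℤ × ℤ) :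
    haarCoeff b I = len I ^ (-(1 / 2) : ℝ) •
      ((∫ x in dyadic (rightHalf I), b x) - ∫ x in dyadic (leftHalf I), b x) := by
  simp only [haarCoeff, haar_smul]
  rw [integral_smul, integral_sub, integral_indicator (measurableSet_dyadic _),
    integral_indicator (measurableSet_dyadic _)]
  · exact (integrableOn_dyadic hb _).integrable_indicator (measurableSet_dyadic _)
  · exact (integrableOn_dyadic hb _).integrable_indicator (measurableSet_dyadic _)

/-- The half-difference `(b_{I_+} - b_{I_-}) / 2` of the averages over the two halves. -/
def mdiff (b : ℝ → 𝕜) (I : ℤ × ℤ) : 𝕜 := (2⁻¹ : ℝ) • (avg b (rightHalf I) - avg b (leftHalf I))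

lemma avg_rightHalf {b : ℝ → 𝕜} (hb : LocallyIntegrable b volume) (I : ℤ × ℤ) :
    avg b (rightHalf I) = avg b I + mdiff b I := by
  have : avg b I = (2⁻¹ : ℝ) • (avg b (rightHalf I) + avg b (leftHalf I)) := by
    simp only [avg, integral_halves hb I, len_leftHalf, len_rightHalf, smul_add, smul_smul]
    rw [add_comm]; congr 2 <;> field_simp
  rw [this, mdiff]; module

lemma avg_leftHalf {b : ℝ → 𝕜} (hb : LocallyIntegrable b volume) (I : ℤ × ℤ) :
    avg b (leftHalf I) = avg b I - mdiff b I := by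
  have := avg_rightHalf hb I
  have h2 : avg b (leftHalf I) = avg b (rightHalf I) - (2 : ℝ) • mdiff b I := by
    rw [mdiff]; module
  rw [h2, this]; module

/-- Links the BMO sum to the martingale jumps: `mdiff b J` is the increment by which the average
moves on passing to a half. -/
lemma norm_haarCoeff_sq {b : ℝ → 𝕜} (hb : LocallyIntegrable b volume) (I : ℤ × ℤ) :
    ‖haarCoeff b I‖ ^ 2 = len I * ‖mdiff b I‖ ^ 2 := by
  have h : haarCoeff b I = (len I ^ (-(1 / 2) : ℝ) * len I) • mdiff b I := by
    rw [haarCoeff_eq hb, ← len_smul_avg, ← len_smul_avg, len_leftHalf, len_rightHalf, mdiff]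
    module
  have h2 : (len I ^ (-(1 / 2) : ℝ) * len I) ^ 2 = len I := by
    rw [mul_pow, ← Real.rpow_natCast, ← Real.rpow_mul (len_pos I).le]
    norm_num
    rw [Real.rpow_neg_one]
    field_simp [(len_pos I).ne']
  rw [h, norm_smul, mul_pow, Real.norm_eq_abs, sq_abs, h2]

/-- The local sum `∑_{I ⊆ J} |⟨b, h_I⟩|²`. -/
def carlesonSum (b : ℝ → 𝕜) (J : ℤ × ℤ) : ℝ≥0∞ :=
  ∑' I : {I : ℤ × ℤ // dyadic I ⊆ dyadic J}, ‖haarCoeff b I.1‖ₑ ^ 2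

/-- Intervals inside the left half, inside the right half, and J itself are disjoint families of
subintervals of J. Divided by |J|, this is the hypothesis of `bellman_exp`. -/
lemma carlesonSum_halves (b : ℝ → 𝕜) (J : ℤ × ℤ) :
    carlesonSum b (leftHalf J) + carlesonSum b (rightHalf J) + ‖haarCoeff b J‖ₑ ^ 2
      ≤ carlesonSum b J := by
  have e : ∀ K, carlesonSum b K =
      ∑' I, {I : ℤ × ℤ | dyadic I ⊆ dyadic K}.indicator (fun I => ‖haarCoeff b I‖ₑ ^ 2) I :=
    fun K => tsum_subtype {I : ℤ × ℤ | dyadic I ⊆ dyadic K} (fun I => ‖haarCoeff b I‖ₑ ^ 2)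
  have e2 : ‖haarCoeff b J‖ₑ ^ 2 =
      ∑' I, ({J} : Set (ℤ × ℤ)).indicator (fun I => ‖haarCoeff b I‖ₑ ^ 2) I := by
    rw [← tsum_subtype, tsum_singleton J (fun I => ‖haarCoeff b I‖ₑ ^ 2)]
  rw [e, e, e, e2, ← ENNReal.tsum_add, ← ENNReal.tsum_add]
  refine ENNReal.tsum_le_tsum fun I => ?_
  by_cases h1 : dyadic I ⊆ dyadic (leftHalf J)
  · have h2 : ¬ dyadic I ⊆ dyadic (rightHalf J) := fun h2 => by
      obtain ⟨x, hx⟩ := nonempty_dyadic I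
      exact Set.disjoint_left.1 (disjoint_halves J) (h1 hx) (h2 hx)
    have h3 : I ≠ J := by
      rintro rfl
      have := level_le_of_subset h1
      simp [leftHalf] at this
    have h4 : dyadic I ⊆ dyadic J := h1.trans (dyadic_leftHalf_subset J)
    simp [h1, h2, h3, h4]
  · by_cases h2 : dyadic I ⊆ dyadic (rightHalf J)
    · have h3 : I ≠ J := by
        rintro rfl
        have := level_le_of_subset h2
        simp [rightHalf] at this
      have h4 : dyadic I ⊆ dyadic J := h2.trans (dyadic_rightHalf_subset J)
      simp [h1, h2, h3, h4]
    · by_cases h3 : I = J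
      · subst h3; simp [h1, h2]
      · simp [h1, h2, h3]

lemma carlesonSum_le (b : ℝ → 𝕜) (J : ℤ × ℤ) :
    carlesonSum b J ≤ ENNReal.ofReal (len J) * bmoNorm b ^ 2 := by
  have h : ((ENNReal.ofReal (len J))⁻¹ * carlesonSum b J) ^ (1 / 2 : ℝ) ≤ bmoNorm b :=
    le_iSup (fun J : ℤ × ℤ => ((ENNReal.ofReal (len J))⁻¹ * carlesonSum b J) ^ (1 / 2 : ℝ)) J
  have h2 := ENNReal.rpow_le_rpow h (by norm_num : (0 : ℝ) ≤ 2)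
  rw [← ENNReal.rpow_mul] at h2
  norm_num at h2
  have h0 : ENNReal.ofReal (len J) ≠ 0 := by simp [len_pos]
  rwa [mul_comm, ← div_eq_mul_inv, ENNReal.div_le_iff h0 ENNReal.ofReal_ne_top, mul_comm] at h2

/-! ### The John–Nirenberg inequality -/

/-- Main inequality for the Bellman function e^u g(A), g(A) = 1 + 4A - 8A², where u is the average
and A the normalised square sum. Here d is the jump of u, and a, c are the values of A on the
halves. -/
lemma bellman_exp {a c d A : ℝ} (ha : 0 ≤ a) (hc : 0 ≤ c) (hA : A ≤ 1 / 20)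
    (h : (a + c) / 2 + d ^ 2 ≤ A) :
    Real.exp d * (1 + 4 * a - 8 * a ^ 2) + Real.exp (-d) * (1 + 4 * c - 8 * c ^ 2)
      ≤ 2 * (1 + 4 * A - 8 * A ^ 2) := by
  have hd1 : |d| ≤ 1 := by
    rw [← Real.sqrt_sq_eq_abs]
    exact Real.sqrt_le_one.2 (by linarith)
  have e1 : Real.exp d ≤ 1 + d + d ^ 2 := by
    have := (abs_le.1 (Real.abs_exp_sub_one_sub_id_le hd1)).2
    linarith
  have e2 : Real.exp (-d) ≤ 1 - d + d ^ 2 := by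
    have := (abs_le.1 (Real.abs_exp_sub_one_sub_id_le (x := -d) (by rwa [abs_neg]))).2
    nlinarith
  have d0 := sq_nonneg d
  have ga : 0 ≤ 1 + 4 * a - 8 * a ^ 2 := by nlinarith
  have gc : 0 ≤ 1 + 4 * c - 8 * c ^ 2 := by nlinarith
  have m1 := mul_le_mul_of_nonneg_right e1 ga
  have m2 := mul_le_mul_of_nonneg_right e2 gc
  obtain ⟨s, hs⟩ : ∃ s, s = (a + c) / 2 := ⟨_, rfl⟩
  obtain ⟨δ, hδ⟩ : ∃ δ, δ = (a - c) / 2 := ⟨_, rfl⟩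
  have ea : a = s + δ := by rw [hs, hδ]; ring
  have ec : c = s - δ := by rw [hs, hδ]; ring
  have hs0 : 0 ≤ s := by rw [hs]; linarith
  rw [← hs] at h
  have mono : 1 + 4 * (s + d ^ 2) - 8 * (s + d ^ 2) ^ 2 ≤ 1 + 4 * A - 8 * A ^ 2 := by
    nlinarith
  refine (add_le_add m1 m2).trans (le_trans ?_ (mul_le_mul_of_nonneg_left mono zero_le_two))
  have hs1 : s + d ^ 2 ≤ 1 / 20 := h.trans hA
  -- The cross term from d (g(a) - g(c)) is absorbed by the concavity gain 8δ² of g, at the cost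
  -- d²/2.
  have k1 : 4 * (d * δ) * (1 - 4 * s) ≤ 8 * δ ^ 2 + d ^ 2 / 2 := by
    have : 4 * (d * δ) * (1 - 4 * s) ≤ 4 * |d * δ| := by
      have h1 : (d * δ) * (1 - 4 * s) ≤ |d * δ| * (1 - 4 * s) :=
        mul_le_mul_of_nonneg_right (le_abs_self _) (by nlinarith)
      nlinarith [abs_nonneg (d * δ)]
    rw [abs_mul] at this
    nlinarith [sq_nonneg (|d| - 4 * |δ|), sq_abs d, sq_abs δ]
  -- The right side is g(s + d²) - g(s); the slope 4 of g at 0 leaves room for both quadratic errors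
  -- because A ≤ 1/20.
  have k2 : d ^ 2 * (1 + 4 * s - 8 * s ^ 2) + d ^ 2 / 2 ≤
      4 * d ^ 2 - 16 * s * d ^ 2 - 8 * (d ^ 2) ^ 2 := by
    nlinarith [mul_nonneg d0 hs0, mul_nonneg d0 (sub_nonneg.2 hs1), mul_nonneg d0 d0,
      mul_nonneg d0 (sq_nonneg s)]
  have k3 : 0 ≤ d ^ 2 * δ ^ 2 := by positivity
  rw [ea, ec]
  nlinarith

/-- Iterates `bellman_exp` down n generations. At the last one g ≥ 1 lets the factor g be dropped.
-/
lemma lintegral_exp_avg_le {b : ℝ → 𝕜} (hb : LocallyIntegrable b volume) (L : 𝕜 →L[ℝ] ℝ)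
    {A : ℤ × ℤ → ℝ} (hA0 : ∀ J, 0 ≤ A J) (hA1 : ∀ J, A J ≤ 1 / 20)
    (hA : ∀ J, (A (leftHalf J) + A (rightHalf J)) / 2 + L (mdiff b J) ^ 2 ≤ A J) (n : ℕ) :
    ∀ J : ℤ × ℤ, ∫⁻ x in dyadic J, ENNReal.ofReal (Real.exp (L (avg b (idx (J.2 - n) x)))) ≤
      ENNReal.ofReal (len J * (Real.exp (L (avg b J)) * (1 + 4 * A J - 8 * A J ^ 2))) := by
  have g1 : ∀ J, 1 ≤ 1 + 4 * A J - 8 * A J ^ 2 := fun J => by nlinarith [hA0 J, hA1 J]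
  induction n with
  | zero =>
    intro J
    have : ∫⁻ x in dyadic J, ENNReal.ofReal (Real.exp (L (avg b (idx (J.2 - (0 : ℕ)) x)))) =
        ∫⁻ x in dyadic J, ENNReal.ofReal (Real.exp (L (avg b J))) := by
      refine setLIntegral_congr_fun (measurableSet_dyadic J) fun x hx => ?_
      simp only [Nat.cast_zero, sub_zero, mem_dyadic_iff.1 hx]
    rw [this, setLIntegral_const, volume_dyadic, mul_comm, ← ENNReal.ofReal_mul (len_pos J).le]
    refine ENNReal.ofReal_le_ofReal (mul_le_mul_of_nonneg_left ?_ (len_pos J).le)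
    exact le_mul_of_one_le_right (Real.exp_pos _).le (g1 J)
  | succ n ih =>
    intro J
    have e1 : J.2 - ((n + 1 : ℕ) : ℤ) = (leftHalf J).2 - n := by
      simp only [leftHalf]; push_cast; ring
    have e2 : J.2 - ((n + 1 : ℕ) : ℤ) = (rightHalf J).2 - n := by
      simp only [rightHalf]; push_cast; ring
    rw [setLIntegral_halves]
    have i1 := ih (leftHalf J)
    have i2 := ih (rightHalf J)
    rw [← e1] at i1
    rw [← e2] at i2
    refine (add_le_add i1 i2).trans ?_
    have hl := len_pos J
    rw [← ENNReal.ofReal_add]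
    · apply ENNReal.ofReal_le_ofReal
      rw [avg_leftHalf hb, avg_rightHalf hb, len_leftHalf, len_rightHalf, map_sub, map_add,
        sub_eq_add_neg, Real.exp_add, Real.exp_add]
      have := bellman_exp (d := L (mdiff b J)) (hA0 (rightHalf J)) (hA0 (leftHalf J)) (hA1 J)
        (by have := hA J; linarith)
      have h3 := mul_le_mul_of_nonneg_left this
        (mul_nonneg (half_pos hl).le (Real.exp_pos (L (avg b J))).le)
      nlinarith
    · have := g1 (leftHalf J)
      have := len_pos (leftHalf J)
      positivity
    · have := g1 (rightHalf J)
      have := len_pos (rightHalf J)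
      positivity

/-- Lebesgue differentiation along dyadic intervals. -/
lemma ae_tendsto_avg {b : ℝ → 𝕜} (hb : LocallyIntegrable b volume) (k : ℤ) :
    ∀ᵐ x : ℝ, Filter.Tendsto (fun n : ℕ => avg b (idx (k - n) x)) Filter.atTop (nhds (b x)) := by
  filter_upwards [IsUnifLocDoublingMeasure.ae_tendsto_average (μ := volume) hb 1] with x hx
  -- The closed ball about the midpoint with radius half the length is the closure of the dyadic
  -- interval, and it contains x.
  have key := hx (l := Filter.atTop)
    (fun n : ℕ => ((idx (k - n) x).1 : ℝ) * len (idx (k - n) x) + len (idx (k - n) x) / 2)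
    (fun n : ℕ => len (idx (k - n) x) / 2) ?_ ?_
  · refine key.congr fun n => ?_
    set I := idx (k - n) x
    rw [Real.closedBall_eq_Icc, setAverage_eq, avg]
    have h1 : Set.Icc ((I.1 : ℝ) * len I + len I / 2 - len I / 2)
        ((I.1 : ℝ) * len I + len I / 2 + len I / 2) =
        Set.Icc ((I.1 : ℝ) * len I) ((I.1 : ℝ) * len I + len I) := by
      congr 1 <;> ring
    rw [h1, dyadic_eq_Ico, integral_Icc_eq_integral_Ico, Measure.real, Real.volume_Icc,
      ENNReal.toReal_ofReal (by linarith [len_pos I])]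
    congr 2; ring
  · rw [tendsto_nhdsWithin_iff]
    refine ⟨?_, Filter.Eventually.of_forall fun n => half_pos (len_pos _)⟩
    have : (fun n : ℕ => len (idx (k - n) x) / 2) = fun n : ℕ => (2 ^ k / 2 : ℝ) * (1 / 2) ^ n := by
      funext n
      simp only [len, idx_snd]
      rw [zpow_sub₀ (by norm_num), zpow_natCast, one_div, inv_pow]
      ring
    rw [this]
    simpa using (tendsto_pow_atTop_nhds_zero_of_lt_one (by norm_num : (0 : ℝ) ≤ 1 / 2)
      (by norm_num)).const_mul (2 ^ k / 2 : ℝ)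
  · refine Filter.Eventually.of_forall fun n => ?_
    have h := mem_dyadic_idx (k - n) x
    rw [dyadic_eq_Ico] at h
    rw [one_mul, Real.closedBall_eq_Icc]
    constructor <;> linarith [h.1, h.2]

/-- With A the square sum scaled by ‖L‖², the finite-generation bound is uniform in n; Lebesgue
differentiation and Fatou pass to the limit. The factor 2 is a crude bound for g on [0, 1/20]. -/
lemma lintegral_exp_sub_avg_le {b : ℝ → 𝕜} (hb : LocallyIntegrable b volume) {β : ℝ}
    (hB : ∀ J, carlesonSum b J ≤ ENNReal.ofReal (len J * β ^ 2)) (L : 𝕜 →L[ℝ] ℝ)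
    (hL : (‖L‖ * β) ^ 2 ≤ 1 / 20) (J : ℤ × ℤ) :
    ∫⁻ x in dyadic J, ENNReal.ofReal (Real.exp (L (b x - avg b J))) ≤
      ENNReal.ofReal (2 * len J) := by
  set A : ℤ × ℤ → ℝ := fun J => ‖L‖ ^ 2 * ((carlesonSum b J).toReal / len J) with hAdef
  have hfin : ∀ J, carlesonSum b J ≠ ∞ := fun J => ne_top_of_le_ne_top ENNReal.ofReal_ne_top (hB J)
  have hA0 : ∀ J, 0 ≤ A J := fun J => by have := len_pos J; positivity
  have hA1 : ∀ J, A J ≤ 1 / 20 := fun J => by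
    refine le_trans ?_ hL
    rw [hAdef, mul_pow]
    refine mul_le_mul_of_nonneg_left ?_ (sq_nonneg _)
    rw [div_le_iff₀ (len_pos J), mul_comm]
    have h := ENNReal.toReal_mono ENNReal.ofReal_ne_top (hB J)
    rwa [ENNReal.toReal_ofReal (by have := len_pos J; positivity)] at h
  have hA : ∀ J, (A (leftHalf J) + A (rightHalf J)) / 2 + L (mdiff b J) ^ 2 ≤ A J := fun J => by
    have h := ENNReal.toReal_mono (hfin J) (carlesonSum_halves b J)
    rw [ENNReal.toReal_add (by simp [hfin]) (by simp), ENNReal.toReal_add (hfin _) (hfin _),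
      ENNReal.toReal_pow, toReal_enorm, norm_haarCoeff_sq hb] at h
    have hl := len_pos J
    have h2 : L (mdiff b J) ^ 2 ≤ ‖L‖ ^ 2 * ‖mdiff b J‖ ^ 2 := by
      rw [← mul_pow, ← sq_abs]
      exact pow_le_pow_left₀ (abs_nonneg _) (L.le_opNorm _) 2
    simp only [hAdef, len_leftHalf, len_rightHalf]
    have h3 : ‖L‖ ^ 2 * (((carlesonSum b (leftHalf J)).toReal +
        (carlesonSum b (rightHalf J)).toReal + len J * ‖mdiff b J‖ ^ 2) / len J) ≤
        ‖L‖ ^ 2 * ((carlesonSum b J).toReal / len J) := by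
      gcongr
    refine le_trans ?_ h3
    have : ‖L‖ ^ 2 * (((carlesonSum b (leftHalf J)).toReal +
        (carlesonSum b (rightHalf J)).toReal + len J * ‖mdiff b J‖ ^ 2) / len J) =
      (‖L‖ ^ 2 * ((carlesonSum b (leftHalf J)).toReal / (len J / 2)) +
        ‖L‖ ^ 2 * ((carlesonSum b (rightHalf J)).toReal / (len J / 2))) / 2 +
        ‖L‖ ^ 2 * ‖mdiff b J‖ ^ 2 := by
      field_simp
    linarith
  have key : ∀ n : ℕ, ∫⁻ x in dyadic J,
      ENNReal.ofReal (Real.exp (L (avg b (idx (J.2 - n) x) - avg b J))) ≤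
        ENNReal.ofReal (2 * len J) := fun n => by
    have h := lintegral_exp_avg_le hb L hA0 hA1 hA n J
    have e : ∀ x, ENNReal.ofReal (Real.exp (L (avg b (idx (J.2 - n) x) - avg b J))) =
        ENNReal.ofReal (Real.exp (-L (avg b J))) *
          ENNReal.ofReal (Real.exp (L (avg b (idx (J.2 - n) x)))) := fun x => by
      rw [← ENNReal.ofReal_mul (Real.exp_pos _).le, ← Real.exp_add, map_sub]
      congr 2; ring
    simp only [e]
    rw [lintegral_const_mul' _ _ ENNReal.ofReal_ne_top]
    refine (mul_le_mul_right h _).trans ?_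
    rw [← ENNReal.ofReal_mul (Real.exp_pos _).le]
    apply ENNReal.ofReal_le_ofReal
    have h4 : Real.exp (-L (avg b J)) * (len J * (Real.exp (L (avg b J)) *
        (1 + 4 * A J - 8 * A J ^ 2))) = len J * (1 + 4 * A J - 8 * A J ^ 2) := by
      rw [Real.exp_neg]; field_simp
    rw [h4]
    nlinarith [len_pos J, hA0 J, hA1 J, sq_nonneg (A J)]
  have hlim : ∀ᵐ x ∂(volume.restrict (dyadic J)),
      ENNReal.ofReal (Real.exp (L (b x - avg b J))) ≤ Filter.liminf (fun n : ℕ =>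
        ENNReal.ofReal (Real.exp (L (avg b (idx (J.2 - n) x) - avg b J)))) Filter.atTop := by
    refine ae_restrict_of_ae ?_
    filter_upwards [ae_tendsto_avg hb J.2] with x hx
    refine le_of_eq (Filter.Tendsto.liminf_eq ?_).symm
    refine ENNReal.tendsto_ofReal ((Real.continuous_exp.tendsto _).comp ?_)
    exact (L.continuous.tendsto _).comp (hx.sub_const _)
  refine (lintegral_mono_ae hlim).trans ((lintegral_liminf_le fun n => ?_).trans ?_)
  · refine ENNReal.measurable_ofReal.comp (Real.measurable_exp.comp ?_)
    exact (measurable_of_countable (fun I => L (avg b I - avg b J))).comp (measurable_idx _)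
  · exact Filter.liminf_le_of_frequently_le' (Filter.Frequently.of_forall key)

lemma abs_pow_le_exp (w : ℝ) {t : ℝ} (ht : 0 < t) (N : ℕ) :
    |w| ^ N ≤ (1 / t) ^ N * N.factorial * (Real.exp (t * w) + Real.exp (-(t * w))) := by
  have h1 := Real.pow_div_factorial_le_exp (t * |w|) (by positivity) N
  have h2 : Real.exp (t * |w|) ≤ Real.exp (t * w) + Real.exp (-(t * w)) := by
    rcases abs_cases w with ⟨h, _⟩ | ⟨h, _⟩ <;> rw [h]
    · linarith [Real.exp_pos (-(t * w))]
    · rw [mul_neg]; linarith [Real.exp_pos (t * w)]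
  have hf : (0 : ℝ) < N.factorial := by positivity
  rw [div_le_iff₀ hf, mul_pow] at h1
  calc |w| ^ N = (1 / t) ^ N * (t ^ N * |w| ^ N) := by
        rw [← mul_assoc, ← mul_pow, one_div, inv_mul_cancel₀ ht.ne', one_pow, one_mul]
    _ ≤ (1 / t) ^ N * (Real.exp (t * |w|) * N.factorial) := by gcongr
    _ ≤ (1 / t) ^ N * ((Real.exp (t * w) + Real.exp (-(t * w))) * N.factorial) := by gcongr
    _ = _ := by ring

/-- Reduces a moment of a scalar to exponentials of the four real functionals ± t re and ± t im. -/
lemma norm_pow_le_exp (z : 𝕜) {t : ℝ} (ht : 0 < t) (N : ℕ) :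
    ‖z‖ ^ N ≤ (2 / t) ^ N * N.factorial *
      (Real.exp (t * RCLike.re z) + Real.exp (-(t * RCLike.re z)) +
        (Real.exp (t * RCLike.im z) + Real.exp (-(t * RCLike.im z)))) := by
  have hI : ‖(RCLike.I : 𝕜)‖ ≤ 1 := by rw [RCLike.norm_I]; split_ifs <;> norm_num
  have h1 : ‖z‖ ≤ |RCLike.re z| + |RCLike.im z| := by
    calc ‖z‖ = ‖(RCLike.re z : 𝕜) + RCLike.im z * RCLike.I‖ := by rw [RCLike.re_add_im z]
      _ ≤ ‖(RCLike.re z : 𝕜)‖ + ‖(RCLike.im z : 𝕜) * RCLike.I‖ := norm_add_le _ _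
      _ ≤ _ := by
        rw [RCLike.norm_ofReal, norm_mul, RCLike.norm_ofReal]
        gcongr
        exact mul_le_of_le_one_right (abs_nonneg _) hI
  calc ‖z‖ ^ N ≤ (|RCLike.re z| + |RCLike.im z|) ^ N := by gcongr
    _ ≤ 2 ^ (N - 1) * (|RCLike.re z| ^ N + |RCLike.im z| ^ N) :=
        add_pow_le (abs_nonneg _) (abs_nonneg _) N
    _ ≤ 2 ^ N * (|RCLike.re z| ^ N + |RCLike.im z| ^ N) := by
        gcongr
        · norm_num
        · omega
    _ ≤ 2 ^ N * ((1 / t) ^ N * N.factorial * _ + (1 / t) ^ N * N.factorial * _) := by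
        gcongr 2 ^ N * (?_ + ?_)
        · exact abs_pow_le_exp _ ht N
        · exact abs_pow_le_exp _ ht N
    _ = _ := by
        rw [show (2 / t) = 2 * (1 / t) by ring, mul_pow]; ring

/-- The **John–Nirenberg inequality**, in terms of moments. -/
lemma lintegral_norm_sub_avg_pow_le {b : ℝ → 𝕜} (hb : LocallyIntegrable b volume) {B : ℝ}
    (hB0 : 0 < B) (hB : bmoNorm b ≤ ENNReal.ofReal B) (N : ℕ) (J : ℤ × ℤ) :
    ∫⁻ x in dyadic J, ‖b x - avg b J‖ₑ ^ N ≤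
      ENNReal.ofReal ((10 * B) ^ N * N.factorial * 8 * len J) := by
  have hC : ∀ J, carlesonSum b J ≤ ENNReal.ofReal (len J * B ^ 2) := fun J => by
    rw [ENNReal.ofReal_mul (len_pos J).le, ENNReal.ofReal_pow hB0.le]
    exact (carlesonSum_le b J).trans (by gcongr)
  -- Then (tB)² = 1/25 is below the threshold 1/20. The four functionals contribute 2|J| each,
  -- whence the 8, and 2/t = 10B.
  set t : ℝ := 1 / (5 * B) with ht
  have ht0 : 0 < t := by positivity
  have H : ∀ L : 𝕜 →L[ℝ] ℝ, (∀ z, |L z| ≤ t * ‖z‖) →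
      ∫⁻ x in dyadic J, ENNReal.ofReal (Real.exp (L (b x - avg b J))) ≤
        ENNReal.ofReal (2 * len J) := fun L hL => by
    refine lintegral_exp_sub_avg_le hb hC L ?_ J
    have h1 : ‖L‖ ≤ t := L.opNorm_le_bound ht0.le hL
    have h2 : ‖L‖ * B ≤ 1 / 5 := by
      calc ‖L‖ * B ≤ t * B := by gcongr
        _ = 1 / 5 := by rw [ht]; field_simp
    have h3 : 0 ≤ ‖L‖ * B := by positivity
    nlinarith
  have r1 := H (t • RCLike.reCLM) fun z => by
    simp only [smul_apply, RCLike.reCLM_apply, smul_eq_mul, abs_mul,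
      abs_of_pos ht0]
    gcongr; exact RCLike.abs_re_le_norm z
  have r2 := H (-(t • RCLike.reCLM)) fun z => by
    simp only [neg_apply, smul_apply, RCLike.reCLM_apply,
      smul_eq_mul, abs_neg, abs_mul, abs_of_pos ht0]
    gcongr; exact RCLike.abs_re_le_norm z
  have r3 := H (t • RCLike.imCLM) fun z => by
    simp only [smul_apply, RCLike.imCLM_apply, smul_eq_mul, abs_mul,
      abs_of_pos ht0]
    gcongr; exact RCLike.abs_im_le_norm z
  have r4 := H (-(t • RCLike.imCLM)) fun z => by
    simp only [neg_apply, smul_apply, RCLike.imCLM_apply,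
      smul_eq_mul, abs_neg, abs_mul, abs_of_pos ht0]
    gcongr; exact RCLike.abs_im_le_norm z
  simp only [neg_apply, smul_apply, RCLike.reCLM_apply,
    RCLike.imCLM_apply, smul_eq_mul] at r1 r2 r3 r4
  have hm : AEMeasurable (fun x => b x - avg b J) (volume.restrict (dyadic J)) :=
    (hb.aestronglyMeasurable.aemeasurable.sub_const _).restrict
  have hre : AEMeasurable (fun x => RCLike.re (b x - avg b J)) (volume.restrict (dyadic J)) :=
    RCLike.measurable_re.comp_aemeasurable hm
  have him : AEMeasurable (fun x => RCLike.im (b x - avg b J)) (volume.restrict (dyadic J)) :=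
    RCLike.measurable_im.comp_aemeasurable hm
  have hpt : ∀ x, ‖b x - avg b J‖ₑ ^ N ≤ ENNReal.ofReal ((2 / t) ^ N * N.factorial) *
      (ENNReal.ofReal (Real.exp (t * RCLike.re (b x - avg b J))) +
        ENNReal.ofReal (Real.exp (-(t * RCLike.re (b x - avg b J)))) +
        (ENNReal.ofReal (Real.exp (t * RCLike.im (b x - avg b J))) +
        ENNReal.ofReal (Real.exp (-(t * RCLike.im (b x - avg b J)))))) := fun x => by
    rw [← ENNReal.ofReal_add (by positivity) (by positivity),
      ← ENNReal.ofReal_add (by positivity) (by positivity),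
      ← ENNReal.ofReal_add (by positivity) (by positivity),
      ← ENNReal.ofReal_mul (by positivity), ← ofReal_norm,
      ← ENNReal.ofReal_pow (norm_nonneg _)]
    exact ENNReal.ofReal_le_ofReal (norm_pow_le_exp _ ht0 N)
  refine (lintegral_mono hpt).trans ?_
  rw [lintegral_const_mul' _ _ ENNReal.ofReal_ne_top, lintegral_add_left' (by fun_prop),
    lintegral_add_left' (by fun_prop), lintegral_add_left' (by fun_prop)]
  refine (mul_le_mul_right (add_le_add (add_le_add r1 r2) (add_le_add r3 r4)) _).trans ?_
  have hl := len_pos J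
  rw [← ENNReal.ofReal_add (by positivity) (by positivity),
    ← ENNReal.ofReal_add (by positivity) (by positivity), ← ENNReal.ofReal_mul (by positivity)]
  apply ENNReal.ofReal_le_ofReal
  have : 2 / t = 10 * B := by rw [ht]; field_simp; norm_num
  rw [this]
  linarith

/-! ### The dyadic maximal inequality -/

/-- The average over a dyadic interval of a function with values in `[0, ∞]`. -/
def lavg (F : ℝ → ℝ≥0∞) (I : ℤ × ℤ) : ℝ≥0∞ := (ENNReal.ofReal (len I))⁻¹ * ∫⁻ x in dyadic I, F x

lemma ofReal_len_ne_zero (I : ℤ × ℤ) : ENNReal.ofReal (len I) ≠ 0 := by simp [len_pos]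

lemma ofReal_len_mul_lavg (F : ℝ → ℝ≥0∞) (I : ℤ × ℤ) :
    ENNReal.ofReal (len I) * lavg F I = ∫⁻ x in dyadic I, F x := by
  rw [lavg, ← mul_assoc, ENNReal.mul_inv_cancel (ofReal_len_ne_zero I) ENNReal.ofReal_ne_top,
    one_mul]

/-- Hölder's inequality on a dyadic interval. -/
lemma lavg_mul_le {p q : ℝ} (hpq : p.HolderConjugate q) {F G : ℝ → ℝ≥0∞}
    {I : ℤ × ℤ} (hF : AEMeasurable F (volume.restrict (dyadic I)))
    (hG : AEMeasurable G (volume.restrict (dyadic I))) :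
    lavg (fun x => F x * G x) I ≤
      lavg (fun x => F x ^ p) I ^ (1 / p) * lavg (fun x => G x ^ q) I ^ (1 / q) := by
  have h := ENNReal.lintegral_mul_le_Lp_mul_Lq (volume.restrict (dyadic I)) hpq hF hG
  have e : (ENNReal.ofReal (len I))⁻¹ = (ENNReal.ofReal (len I))⁻¹ ^ (1 / p) *
      (ENNReal.ofReal (len I))⁻¹ ^ (1 / q) := by
    rw [← ENNReal.rpow_add _ _ (by simp) (by simp [len_pos])]
    simp only [one_div, hpq.inv_add_inv_eq_one, ENNReal.rpow_one]
  have hp := hpq.nonneg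
  have hq := hpq.symm.nonneg
  unfold lavg
  rw [ENNReal.mul_rpow_of_nonneg _ _ (by positivity), ENNReal.mul_rpow_of_nonneg _ _ (by positivity)]
  calc _ ≤ (ENNReal.ofReal (len I))⁻¹ * _ := mul_le_mul_right h _
    _ = (ENNReal.ofReal (len I))⁻¹ ^ (1 / p) *
      (ENNReal.ofReal (len I))⁻¹ ^ (1 / q) * _ := by rw [← e]
    _ = _ := by ring

lemma lavg_const (c : ℝ≥0∞) (I : ℤ × ℤ) : lavg (fun _ => c) I = c := by
  rw [lavg, setLIntegral_const, volume_dyadic, mul_left_comm,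
    ENNReal.inv_mul_cancel (ofReal_len_ne_zero I) ENNReal.ofReal_ne_top, mul_one]

/-- Jensen's inequality on a dyadic interval. -/
lemma lavg_rpow_le {r : ℝ} (hr : 1 ≤ r) {F : ℝ → ℝ≥0∞} {I : ℤ × ℤ}
    (hF : AEMeasurable F (volume.restrict (dyadic I))) :
    lavg F I ^ r ≤ lavg (fun x => F x ^ r) I := by
  rcases hr.eq_or_lt with rfl | hr
  · simp
  have h := lavg_mul_le (Real.HolderConjugate.conjExponent hr) hF
    (aemeasurable_const (b := (1 : ℝ≥0∞)))
  simp only [mul_one, ENNReal.one_rpow, lavg_const] at h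
  have h0 : 0 < r := by linarith
  calc lavg F I ^ r ≤ (lavg (fun x => F x ^ r) I ^ (1 / r)) ^ r := by gcongr
    _ = _ := by rw [← ENNReal.rpow_mul, one_div, inv_mul_cancel₀ h0.ne', ENNReal.rpow_one]

lemma lavg_halves (F : ℝ → ℝ≥0∞) (I : ℤ × ℤ) :
    lavg F I = 2⁻¹ * (lavg F (leftHalf I) + lavg F (rightHalf I)) := by
  have h2 : (ENNReal.ofReal (len I / 2))⁻¹ = 2 * (ENNReal.ofReal (len I))⁻¹ := by
    rw [ENNReal.ofReal_div_of_pos two_pos, ENNReal.inv_div (by simp) (by simp),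
      div_eq_mul_inv]
    simp
  unfold lavg
  rw [setLIntegral_halves, len_leftHalf, len_rightHalf, h2, ← mul_add, mul_assoc, ← mul_assoc 2⁻¹,
    ENNReal.inv_mul_cancel (by simp) (by simp), one_mul]

/-- The running maximum of `m` and the values of `a` at the `n + 1` dyadic intervals of levels
`k - n, …, k` containing `x`. -/
def runMax (a : ℤ × ℤ → ℝ) : ℕ → ℤ → ℝ → ℝ → ℝ
  | 0, k, x, m => max m (a (idx k x))
  | n + 1, k, x, m => runMax a n (k - 1) x (max m (a (idx k x)))

lemma le_runMax (a : ℤ × ℤ → ℝ) (n : ℕ) : ∀ (k : ℤ) (x m : ℝ), m ≤ runMax a n k x m := by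
  induction n with
  | zero => exact fun k x m => le_max_left _ _
  | succ n ih => exact fun k x m => (le_max_left _ _).trans (ih _ _ _)

lemma avg_le_runMax (a : ℤ × ℤ → ℝ) (n : ℕ) :
    ∀ (k : ℤ) (x m : ℝ) (j : ℕ), j ≤ n → a (idx (k - j) x) ≤ runMax a n k x m := by
  induction n with
  | zero =>
    intro k x m j hj
    obtain rfl : j = 0 := by omega
    rw [Nat.cast_zero, sub_zero]; exact le_max_right _ _
  | succ n ih =>
    intro k x m j hj
    rcases j with _ | j
    · rw [Nat.cast_zero, sub_zero]; exact (le_max_right _ _).trans (le_runMax a n _ x _)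
    · have := ih (k - 1) x (max m (a (idx k x))) j (by omega)
      rwa [show k - 1 - (j : ℤ) = k - ((j + 1 : ℕ) : ℤ) by push_cast; ring] at this

lemma measurable_runMax (a : ℤ × ℤ → ℝ) (n : ℕ) :
    ∀ (k : ℤ) {m : ℝ → ℝ}, Measurable m → Measurable fun x => runMax a n k x (m x) := by
  have h : ∀ k, Measurable fun x => a (idx k x) := fun k =>
    (measurable_of_countable a).comp (measurable_idx k)
  induction n with
  | zero => exact fun k m hm => hm.max (h k)
  | succ n ih => exact fun k m hm => ih (k - 1) (hm.max (h k))

/-- The Bellman function for the maximal operator is β^r φ + 2m^r - β m^(r-1) a, with m the running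
maximum, a the average and φ the average of the r-th power. It dominates m^r, since β m^(r-1) a is
at most the larger of m^r and (βa)^r. -/
lemma bellman_max_leaf {r b x m : ℝ} (hr : 1 < r) (hb : 0 ≤ b) (hx : 0 ≤ x) (hm : 0 ≤ m) :
    m ^ r ≤ b ^ r * x ^ r + (2 * m ^ r - b * m ^ (r - 1) * x) := by
  have e : ∀ y : ℝ, 0 ≤ y → y ^ r = y ^ (r - 1) * y := fun y hy => by
    conv_rhs => rw [← Real.rpow_one y, ← Real.rpow_mul hy]
    rw [one_mul]
    rw [← Real.rpow_add_of_nonneg hy (by linarith) zero_le_one, sub_add_cancel]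
  rw [← Real.mul_rpow hb hx]
  have hbx : 0 ≤ b * x := by positivity
  suffices b * m ^ (r - 1) * x ≤ m ^ r + (b * x) ^ r by linarith
  rcases le_total (b * x) m with h | h
  · have : m ^ (r - 1) * (b * x) ≤ m ^ (r - 1) * m := by gcongr
    rw [← e m hm] at this
    nlinarith [Real.rpow_nonneg hbx r]
  · have : m ^ (r - 1) * (b * x) ≤ (b * x) ^ (r - 1) * (b * x) := by
      gcongr
    rw [← e _ hbx] at this
    nlinarith [Real.rpow_nonneg hm r]

/-- Raising the running maximum to the current average does not increase the Bellman function. The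
value β = 2r/(r-1) makes Young's inequality for y m^(r-1) close exactly. -/
lemma bellman_max_step {r y m : ℝ} (hr : 1 < r) (hy : 0 ≤ y) (hm : 0 ≤ m) :
    2 * (max m y) ^ r - 2 * r / (r - 1) * (max m y) ^ (r - 1) * y ≤
      2 * m ^ r - 2 * r / (r - 1) * m ^ (r - 1) * y := by
  rcases le_total y m with h | h
  · rw [max_eq_left h]
  · rw [max_eq_right h]
    have hr1 : 0 < r - 1 := by linarith
    have hc := Real.HolderConjugate.conjExponent hr
    have := Real.young_inequality_of_nonneg hy (Real.rpow_nonneg hm (r - 1)) hc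
    have e1 : (m ^ (r - 1)) ^ r.conjExponent = m ^ r := by
      rw [← Real.rpow_mul hm, Real.conjExponent, mul_div_cancel₀ _ hr1.ne']
    have e2 : y ^ (r - 1) * y = y ^ r := by
      conv_lhs => rw [← Real.rpow_one y, ← Real.rpow_mul hy]
      rw [one_mul, ← Real.rpow_add_of_nonneg hy (by linarith) zero_le_one, sub_add_cancel]
    rw [e1, Real.conjExponent] at this
    rw [mul_assoc, mul_assoc, e2]
    have h3 : m ^ r / (r / (r - 1)) = m ^ r * (r - 1) / r := by field_simp
    rw [h3] at this
    have h4 := mul_le_mul_of_nonneg_left this (by positivity : 0 ≤ 2 * r / (r - 1))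
    have h5 : 2 * r / (r - 1) * (y ^ r / r + m ^ r * (r - 1) / r) =
      2 * r / (r - 1) * y ^ r - 2 * y ^ r + 2 * m ^ r := by
      have : r ≠ 0 := by linarith
      field_simp; ring
    rw [h5] at h4
    linarith

/-- For frozen m the Bellman function is linear in (φ, a), so halving an interval preserves it
exactly; all the loss is in `bellman_max_step`. -/
lemma setLIntegral_runMax_le {r : ℝ} (hr : 1 < r) {a φ : ℤ × ℤ → ℝ} (ha : ∀ I, 0 ≤ a I)
    (haφ : ∀ I, a I ^ r ≤ φ I) (hah : ∀ I, a I = (a (leftHalf I) + a (rightHalf I)) / 2)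
    (hφh : ∀ I, φ I = (φ (leftHalf I) + φ (rightHalf I)) / 2) (n : ℕ) :
    ∀ (J : ℤ × ℤ) {m : ℝ}, 0 ≤ m →
      ∫⁻ x in dyadic J, ENNReal.ofReal (runMax a n J.2 x m ^ r) ≤
        ENNReal.ofReal (len J * ((2 * r / (r - 1)) ^ r * φ J +
          (2 * (max m (a J)) ^ r - 2 * r / (r - 1) * (max m (a J)) ^ (r - 1) * a J))) := by
  have hb : 0 ≤ 2 * r / (r - 1) := div_nonneg (by linarith) (by linarith)
  have leaf : ∀ J {m : ℝ}, 0 ≤ m → m ^ r ≤ (2 * r / (r - 1)) ^ r * φ J +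
          (2 * m ^ r - 2 * r / (r - 1) * m ^ (r - 1) * a J) := fun J m hm => by
    refine (bellman_max_leaf hr hb (ha J) hm).trans ?_
    gcongr
    exact haφ J
  have nn : ∀ J {m : ℝ}, 0 ≤ m → 0 ≤ len J * ((2 * r / (r - 1)) ^ r * φ J +
          (2 * m ^ r - 2 * r / (r - 1) * m ^ (r - 1) * a J)) := fun J m hm =>
    mul_nonneg (len_pos J).le ((Real.rpow_nonneg hm r).trans (leaf J hm))
  induction n with
  | zero =>
    intro J m hm
    have : ∫⁻ x in dyadic J, ENNReal.ofReal (runMax a 0 J.2 x m ^ r) =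
        ∫⁻ x in dyadic J, ENNReal.ofReal (max m (a J) ^ r) := by
      refine setLIntegral_congr_fun (measurableSet_dyadic J) fun x hx => ?_
      simp only [runMax, mem_dyadic_iff.1 hx]
    rw [this, setLIntegral_const, volume_dyadic, mul_comm, ← ENNReal.ofReal_mul (len_pos J).le]
    exact ENNReal.ofReal_le_ofReal (mul_le_mul_of_nonneg_left
      (leaf J (hm.trans (le_max_left _ _))) (len_pos J).le)
  | succ n ih =>
    intro J m hm
    set m' := max m (a J) with hm'
    have hm0 : 0 ≤ m' := hm.trans (le_max_left _ _)
    have step : ∀ K, dyadic K ⊆ dyadic J → K.2 = J.2 - 1 →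
        ∫⁻ x in dyadic K, ENNReal.ofReal (runMax a (n + 1) J.2 x m ^ r) ≤
        ENNReal.ofReal (len K * ((2 * r / (r - 1)) ^ r * φ K +
          (2 * m' ^ r - 2 * r / (r - 1) * m' ^ (r - 1) * a K))) := fun K hK hK2 => by
      have : ∫⁻ x in dyadic K, ENNReal.ofReal (runMax a (n + 1) J.2 x m ^ r) =
          ∫⁻ x in dyadic K, ENNReal.ofReal (runMax a n K.2 x m' ^ r) := by
        refine setLIntegral_congr_fun (measurableSet_dyadic K) fun x hx => ?_
        simp only [runMax, mem_dyadic_iff.1 (hK hx), hK2, hm']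
      rw [this]
      refine (ih K hm0).trans (ENNReal.ofReal_le_ofReal ?_)
      have := bellman_max_step hr (ha K) hm0
      have hl := (len_pos K).le
      gcongr len K * (_ + ?_)
    rw [setLIntegral_halves]
    refine (add_le_add (step _ (dyadic_leftHalf_subset J) rfl)
      (step _ (dyadic_rightHalf_subset J) rfl)).trans ?_
    rw [← ENNReal.ofReal_add (nn _ hm0) (nn _ hm0)]
    apply ENNReal.ofReal_le_ofReal
    rw [len_leftHalf, len_rightHalf, hah J, hφh J]
    apply le_of_eq; ring

/-- The dyadic maximal function is bounded on `L^r`, `1 < r < ∞`. -/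
lemma lintegral_maximal_le {r : ℝ} (hr : 1 < r) {F : ℝ → ℝ≥0∞} (hF : AEMeasurable F volume) :
    ∫⁻ x, (⨆ k : ℤ, lavg F (idx k x)) ^ r ≤
      ENNReal.ofReal ((2 * r / (r - 1)) ^ r) * ∫⁻ x, F x ^ r := by
  have hr0 : 0 < r := by linarith
  have hb : 0 < 2 * r / (r - 1) := div_pos (by linarith) (by linarith)
  by_cases hfin : ∫⁻ x, F x ^ r = ∞
  · rw [hfin, ENNReal.mul_top]
    · exact le_top
    · have : 0 < (2 * r / (r - 1)) ^ r := Real.rpow_pos_of_pos hb r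
      simpa using this
  have hφ : ∀ I, lavg (fun x => F x ^ r) I ≠ ∞ := fun I =>
    ENNReal.mul_ne_top (by simp [len_pos])
      (ne_top_of_le_ne_top hfin (setLIntegral_le_lintegral _ _))
  have hle : ∀ I, lavg F I ^ r ≤ lavg (fun x => F x ^ r) I := fun I => lavg_rpow_le hr.le hF.restrict
  have ha : ∀ I, lavg F I ≠ ∞ := fun I h => by
    have := hle I
    rw [h, ENNReal.top_rpow_of_pos hr0] at this
    exact hφ I (top_le_iff.1 this)
  set a : ℤ × ℤ → ℝ := fun I => (lavg F I).toReal with had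
  set φ : ℤ × ℤ → ℝ := fun I => (lavg (fun x => F x ^ r) I).toReal with hφd
  have h1 : ∀ I, 0 ≤ a I := fun I => ENNReal.toReal_nonneg
  have h2 : ∀ I, a I ^ r ≤ φ I := fun I => by
    rw [had, hφd]
    simp only
    rw [ENNReal.toReal_rpow]
    exact ENNReal.toReal_mono (hφ I) (hle I)
  have hhalf : ∀ G : ℝ → ℝ≥0∞, (∀ I, lavg G I ≠ ∞) → ∀ I, (lavg G I).toReal =
      ((lavg G (leftHalf I)).toReal + (lavg G (rightHalf I)).toReal) / 2 := fun G hG I => by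
    rw [lavg_halves, ENNReal.toReal_mul, ENNReal.toReal_add (hG _) (hG _)]
    simp; ring
  -- The maximum runs over the levels -n, …, n, which exhaust ℤ; Fatou then gives the full supremum.
  have key : ∀ n : ℕ, ∫⁻ x, ENNReal.ofReal (runMax a (2 * n) n x 0 ^ r) ≤
      ENNReal.ofReal ((2 * r / (r - 1)) ^ r) * ∫⁻ x, F x ^ r := fun n => by
    rw [lintegral_eq_tsum_level n, lintegral_eq_tsum_level n (fun x => F x ^ r),
      ← ENNReal.tsum_mul_left]
    refine ENNReal.tsum_le_tsum fun j => ?_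
    refine (setLIntegral_runMax_le hr h1 h2 (hhalf _ ha) (hhalf _ hφ) (2 * n) (j, n) le_rfl).trans ?_
    rw [← ofReal_len_mul_lavg, mul_left_comm, ← ENNReal.ofReal_toReal (hφ _),
      ← ENNReal.ofReal_mul (by positivity), ← ENNReal.ofReal_mul (len_pos _).le]
    apply ENNReal.ofReal_le_ofReal
    refine mul_le_mul_of_nonneg_left ?_ (len_pos _).le
    rw [max_eq_right (h1 _)]
    -- Starting from m = 0, the part of the Bellman function other than β^r φ is at most 0.
    have := bellman_max_step hr (h1 (j, n)) le_rfl
    rw [max_eq_right (h1 _), Real.zero_rpow hr0.ne', Real.zero_rpow (by linarith)] at this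
    linarith
  have hlim : ∀ x, (⨆ k : ℤ, lavg F (idx k x)) ^ r ≤
      Filter.liminf (fun n : ℕ => ENNReal.ofReal (runMax a (2 * n) n x 0 ^ r)) Filter.atTop := by
    intro x
    rw [← ENNReal.le_rpow_inv_iff hr0]
    refine iSup_le fun k => ?_
    rw [ENNReal.le_rpow_inv_iff hr0]
    refine Filter.le_liminf_of_le (by isBoundedDefault) ?_
    filter_upwards [Filter.eventually_ge_atTop k.natAbs] with n hn
    rw [← ENNReal.ofReal_toReal (ha (idx k x)),
      ENNReal.ofReal_rpow_of_nonneg ENNReal.toReal_nonneg hr0.le]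
    apply ENNReal.ofReal_le_ofReal
    have := avg_le_runMax a (2 * n) n x 0 (n - k).toNat (by omega)
    rw [show (n : ℤ) - ((n - k).toNat : ℤ) = k by omega] at this
    exact Real.rpow_le_rpow ENNReal.toReal_nonneg this hr0.le
  refine (lintegral_mono hlim).trans ((lintegral_liminf_le fun n => ?_).trans
    (Filter.liminf_le_of_frequently_le' (Filter.Frequently.of_forall key)))
  exact ENNReal.measurable_ofReal.comp
    ((measurable_runMax a (2 * n) n measurable_const).pow_const r)

/-! ### Hedberg's inequality -/

lemma two_zpow_rpow (k : ℤ) (t : ℝ) : ((2 : ℝ) ^ k) ^ t = (2 : ℝ) ^ ((k : ℝ) * t) := by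
  rw [← Real.rpow_intCast, ← Real.rpow_mul (by norm_num)]

/-- The terms decay like 2^(jθ) as j → -∞ and like 2^(j(θ - 1/p)) = 2^(-j/q) as j → +∞. -/
lemma summable_hedberg {θ p q : ℝ} (hθ : 0 < θ) (hq : 0 < q) (h : θ + 1 / q = 1 / p) :
    Summable fun j : ℤ => (2 : ℝ) ^ ((j : ℝ) * θ) * min 1 ((2 : ℝ) ^ ((1 - (j : ℝ)) / p)) := by
  have nn : ∀ j : ℤ, 0 ≤ (2 : ℝ) ^ ((j : ℝ) * θ) * min 1 ((2 : ℝ) ^ ((1 - (j : ℝ)) / p)) :=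
    fun j => by positivity
  have geo : ∀ t : ℝ, 0 < t → Summable fun n : ℕ => (2 : ℝ) ^ (-(n * t) : ℝ) := fun t ht => by
    have : (fun n : ℕ => (2 : ℝ) ^ (-(n * t) : ℝ)) = fun n : ℕ => ((2 : ℝ) ^ (-t)) ^ n := by
      funext n
      rw [← Real.rpow_natCast, ← Real.rpow_mul (by norm_num)]
      congr 1; ring
    rw [this]
    exact summable_geometric_of_lt_one (by positivity)
      (Real.rpow_lt_one_of_one_lt_of_neg (by norm_num) (by linarith))
  refine Summable.of_nat_of_neg ?_ ?_
  · refine Summable.of_nonneg_of_le (fun n => nn n) (fun n => ?_)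
      ((geo (1 / q) (by positivity)).mul_left ((2 : ℝ) ^ (1 / p)))
    calc _ ≤ (2 : ℝ) ^ (((n : ℤ) : ℝ) * θ) * (2 : ℝ) ^ ((1 - ((n : ℤ) : ℝ)) / p) := by
          gcongr; exact min_le_right _ _
      _ = _ := by
          rw [← Real.rpow_add (by norm_num), ← Real.rpow_add (by norm_num)]
          congr 1
          push_cast
          rw [show θ = 1 / p - 1 / q by linarith]; ring
  · refine Summable.of_nonneg_of_le (fun n => nn _) (fun n => ?_) (geo θ hθ)
    calc _ ≤ (2 : ℝ) ^ (((-(n : ℤ) : ℤ) : ℝ) * θ) * 1 := by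
          gcongr; exact min_le_left _ _
      _ = _ := by
          rw [mul_one]; congr 1; push_cast; ring

lemma hedberg_real {θ p q : ℝ} (hp : 0 < p) (h : θ + 1 / q = 1 / p) (hθ : 0 < θ) {m L : ℝ}
    (hm : 0 < m) (hL : 0 < L) : ∃ K : ℤ, ∀ j : ℤ,
      (2 : ℝ) ^ (((K + j : ℤ) : ℝ) * θ) * min m ((2 : ℝ) ^ (-(((K + j : ℤ) : ℝ) / p)) * L) ≤
        (2 : ℝ) ^ ((j : ℝ) * θ) * min 1 ((2 : ℝ) ^ ((1 - (j : ℝ)) / p)) *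
          (m ^ (p / q) * L ^ (1 - p / q)) := by
  have hy : 1 < (2 : ℝ) ^ (1 / p) := Real.one_lt_rpow (by norm_num) (by positivity)
  -- K is the scale at which the bounds m and 2^(-k/p) L cross, up to one step of 2^(1/p); scales
  -- are then measured relative to K.
  obtain ⟨K, hK1, hK2⟩ := exists_mem_Ico_zpow (div_pos hL hm) hy
  have e : ∀ n : ℤ, ((2 : ℝ) ^ (1 / p)) ^ n = (2 : ℝ) ^ ((n : ℝ) / p) := fun n => by
    rw [← Real.rpow_intCast, ← Real.rpow_mul (by norm_num)]; congr 1; ring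
  rw [e] at hK1 hK2
  refine ⟨K, fun j => ?_⟩
  have hLm : L ≤ m * (2 : ℝ) ^ (((K + 1 : ℤ) : ℝ) / p) := by
    rw [div_lt_iff₀ hm] at hK2; linarith
  have h1 : (2 : ℝ) ^ (-(((K + j : ℤ) : ℝ) / p)) * L ≤ m * (2 : ℝ) ^ ((1 - (j : ℝ)) / p) := by
    calc _ ≤ (2 : ℝ) ^ (-(((K + j : ℤ) : ℝ) / p)) * (m * (2 : ℝ) ^ (((K + 1 : ℤ) : ℝ) / p)) := by
          gcongr
      _ = m * ((2 : ℝ) ^ (-(((K + j : ℤ) : ℝ) / p)) * (2 : ℝ) ^ (((K + 1 : ℤ) : ℝ) / p)) := by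
          ring
      _ = _ := by
          rw [← Real.rpow_add (by norm_num)]
          congr 2; push_cast; ring
  have h2 : min m ((2 : ℝ) ^ (-(((K + j : ℤ) : ℝ) / p)) * L) ≤
      m * min 1 ((2 : ℝ) ^ ((1 - (j : ℝ)) / p)) := by
    rw [mul_min_of_nonneg _ _ hm.le, mul_one]
    exact min_le_min_left _ h1
  have hpθ : p * θ = 1 - p / q := by
    rw [show θ = 1 / p - 1 / q by linarith]; field_simp
  have h3 : (2 : ℝ) ^ ((K : ℝ) * θ) ≤ (L / m) ^ (1 - p / q) := by
    have : (2 : ℝ) ^ ((K : ℝ) * θ) = ((2 : ℝ) ^ ((K : ℝ) / p)) ^ (1 - p / q) := by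
      rw [← Real.rpow_mul (by norm_num), ← hpθ]; congr 1; field_simp
    rw [this]
    exact Real.rpow_le_rpow (by positivity) hK1 (by rw [← hpθ]; positivity)
  have h4 : (L / m) ^ (1 - p / q) * m = m ^ (p / q) * L ^ (1 - p / q) := by
    rw [Real.div_rpow hL.le hm.le, div_mul_eq_mul_div, mul_comm (L ^ _), mul_div_right_comm]
    congr 1
    conv_lhs => rw [← Real.rpow_one m, ← Real.rpow_mul hm.le]
    rw [one_mul, ← Real.rpow_sub hm]; congr 1; ring
  calc _ ≤ (2 : ℝ) ^ (((K + j : ℤ) : ℝ) * θ) * (m * min 1 ((2 : ℝ) ^ ((1 - (j : ℝ)) / p))) := by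
        gcongr
    _ = (2 : ℝ) ^ ((j : ℝ) * θ) * min 1 ((2 : ℝ) ^ ((1 - (j : ℝ)) / p)) *
        ((2 : ℝ) ^ ((K : ℝ) * θ) * m) := by
        rw [show ((K + j : ℤ) : ℝ) * θ = (j : ℝ) * θ + K * θ by push_cast; ring,
          Real.rpow_add (by norm_num)]; ring
    _ ≤ _ := by
        rw [← h4]; gcongr

/-- Summing the better of the two bounds gives geometric decay on both sides of the crossover, hence
the interpolated bound. In the application m is a maximal function at a point and L a global L^p
norm. -/
lemma hedberg {θ p q : ℝ} (hp : 0 < p) (hpq : p < q) (h : θ + 1 / q = 1 / p) :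
    ∃ C : ℝ≥0, 0 < C ∧ ∀ (u : ℤ → ℝ≥0∞) (m L : ℝ≥0∞), L ≠ 0 → L ≠ ∞ → (∀ k, u k ≤ m) →
      (∀ k, u k ≤ ENNReal.ofReal (((2 : ℝ) ^ k) ^ (-(1 / p))) * L) →
      ∑' k, ENNReal.ofReal (((2 : ℝ) ^ k) ^ θ) * u k ≤ C * (m ^ (p / q) * L ^ (1 - p / q)) := by
  have hq : 0 < q := hp.trans hpq
  have hθ : 0 < θ := by
    have : 1 / q < 1 / p := one_div_lt_one_div_of_lt hp hpq
    linarith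
  have hs := summable_hedberg hθ hq h
  have nn : ∀ j : ℤ, 0 ≤ (2 : ℝ) ^ ((j : ℝ) * θ) * min 1 ((2 : ℝ) ^ ((1 - (j : ℝ)) / p)) :=
    fun j => by positivity
  set S := ∑' j : ℤ, (2 : ℝ) ^ ((j : ℝ) * θ) * min 1 ((2 : ℝ) ^ ((1 - (j : ℝ)) / p)) with hS
  have hS0 : 0 < S := hs.tsum_pos nn 0 (by positivity)
  refine ⟨S.toNNReal, Real.toNNReal_pos.2 hS0, fun u m L hL0 hLt hum huL => ?_⟩
  change _ ≤ ENNReal.ofReal S * _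
  have hpq0 : 0 < p / q := by positivity
  rcases eq_or_ne m ∞ with rfl | hmt
  · rw [ENNReal.top_rpow_of_pos hpq0, ENNReal.top_mul, ENNReal.mul_top]
    · exact le_top
    · simpa using hS0
    · rw [Ne, ENNReal.rpow_eq_zero_iff]
      simp [hL0, hLt]
  rcases eq_or_ne m 0 with rfl | hm0
  · have : ∀ k, u k = 0 := fun k => le_antisymm (hum k) zero_le
    simp [this]
  lift m to ℝ≥0 using hmt
  lift L to ℝ≥0 using hLt
  have hm : (0 : ℝ) < m := by
    have : m ≠ 0 := by simpa using hm0
    exact_mod_cast pos_iff_ne_zero.2 this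
  have hL : (0 : ℝ) < L := by
    have : L ≠ 0 := by simpa using hL0
    exact_mod_cast pos_iff_ne_zero.2 this
  obtain ⟨K, hK⟩ := hedberg_real hp h hθ hm hL
  have hR : ((m : ℝ≥0∞) ^ (p / q) * (L : ℝ≥0∞) ^ (1 - p / q)) =
      ENNReal.ofReal ((m : ℝ) ^ (p / q) * (L : ℝ) ^ (1 - p / q)) := by
    rw [ENNReal.ofReal_mul (by positivity), ← ENNReal.ofReal_rpow_of_pos hm,
      ← ENNReal.ofReal_rpow_of_pos hL]; simp
  rw [hR, hS, ENNReal.ofReal_tsum_of_nonneg nn hs, ← ENNReal.tsum_mul_right,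
    ← (Equiv.addLeft K).tsum_eq]
  refine ENNReal.tsum_le_tsum fun j => ?_
  rw [← ENNReal.ofReal_mul (nn j)]
  refine le_trans ?_ (ENNReal.ofReal_le_ofReal (hK j))
  have hu : u (K + j) ≤ ENNReal.ofReal
      (min (m : ℝ) ((2 : ℝ) ^ (-(((K + j : ℤ) : ℝ) / p)) * L)) := by
    rcases min_cases (m : ℝ) ((2 : ℝ) ^ (-(((K + j : ℤ) : ℝ) / p)) * L) with ⟨h, _⟩ | ⟨h, _⟩
    · rw [h, ENNReal.ofReal_coe_nnreal]; exact hum _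
    · rw [h, ENNReal.ofReal_mul (by positivity), ENNReal.ofReal_coe_nnreal]
      refine (huL _).trans (le_of_eq ?_)
      rw [two_zpow_rpow]; congr 3; ring
  rw [ENNReal.ofReal_mul (by positivity), ← two_zpow_rpow]
  exact mul_le_mul_right hu _

/-! ### Fractional integral operators with weights -/

/-- The positive series `∑_I |I|^(-α) c_I(x) 1_I(x)`. -/
def fracSum (α : ℝ) (c : ℤ × ℤ → ℝ → ℝ≥0∞) (x : ℝ) : ℝ≥0∞ :=
  ∑' I : ℤ × ℤ, (dyadic I).indicator (fun x => ENNReal.ofReal (len I ^ (-α)) * c I x) x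

lemma fracSum_eq (α : ℝ) (c : ℤ × ℤ → ℝ → ℝ≥0∞) (x : ℝ) :
    fracSum α c x = ∑' k : ℤ, ENNReal.ofReal (len (idx k x) ^ (-α)) * c (idx k x) x := by
  rw [← tsum_indicator_dyadic (fun I => ENNReal.ofReal (len I ^ (-α)) * c I x)]
  rfl

lemma aemeasurable_fracSum (α : ℝ) {c : ℤ × ℤ → ℝ → ℝ≥0∞}
    (hc : ∀ I, AEMeasurable (c I) volume) : AEMeasurable (fracSum α c) volume :=
  AEMeasurable.tsum fun I => ((hc I).const_mul _).indicator (measurableSet_dyadic I)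

/-- Pairing form of the operators, from which the transposition in `fracSum_weight_bound` is read
off. -/
lemma lintegral_mul_fracSum (α : ℝ) {c : ℤ × ℤ → ℝ → ℝ≥0∞} {G : ℝ → ℝ≥0∞}
    (hc : ∀ I, AEMeasurable (c I) volume) (hG : AEMeasurable G volume) :
    ∫⁻ x, G x * fracSum α c x =
      ∑' I : ℤ × ℤ, ENNReal.ofReal (len I ^ (-α)) * ∫⁻ x in dyadic I, c I x * G x := by
  simp only [fracSum, ← ENNReal.tsum_mul_left]
  have hm : ∀ I, AEMeasurable (fun x => G x *
      (dyadic I).indicator (fun x => ENNReal.ofReal (len I ^ (-α)) * c I x) x) volume :=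
    fun I => hG.mul (((hc I).const_mul _).indicator (measurableSet_dyadic I))
  rw [lintegral_tsum hm]
  refine tsum_congr fun I => ?_
  rw [← lintegral_const_mul' _ _ ENNReal.ofReal_ne_top, ← lintegral_indicator
    (measurableSet_dyadic I)]
  refine lintegral_congr fun x => ?_
  by_cases hx : x ∈ dyadic I
  · simp only [Set.indicator_of_mem hx]; ring
  · simp only [Set.indicator_of_notMem hx, mul_zero]

/-- Boundedness of `F ↦ ∑_I |I|^(-α) ⟨w_I F⟩ 1_I` from `L^p` to `L^q` if the weights `w_I` have
uniformly bounded `L^s` averages on `I`, where `s > p'`. -/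
lemma fracSum_integral_bound {α p q s : ℝ} (hp : 1 < p) (hpq : p < q)
    (hαpq : 1 - α + 1 / q = 1 / p) (hs : 1 < s) (hsp : s.conjExponent < p) :
    ∃ C : ℝ≥0, 0 < C ∧ ∀ (w : ℤ × ℤ → ℝ → ℝ≥0∞) (κ : ℝ≥0∞) (F : ℝ → ℝ≥0∞),
      (∀ I, AEMeasurable (w I) volume) → AEMeasurable F volume → κ ≠ 0 → κ ≠ ∞ →
      (∀ I, lavg (fun x => w I x ^ s) I ≤ κ ^ s) →
      (∫⁻ x, fracSum α (fun I _ => ∫⁻ y in dyadic I, w I y * F y) x ^ q) ^ (1 / q) ≤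
        C * κ * (∫⁻ x, F x ^ p) ^ (1 / p) := by
  obtain ⟨C, hC0, hC⟩ := hedberg (by linarith : 0 < p) hpq hαpq
  set t := s.conjExponent with ht
  have hst : s.HolderConjugate t := Real.HolderConjugate.conjExponent hs
  have ht0 : 0 < t := hst.symm.pos
  have hp0 : 0 < p := by linarith
  have hq0 : 0 < q := by linarith
  -- The room t < p lets the maximal theorem be applied to F^t in L^(p/t).
  have hr : 1 < p / t := by rwa [one_lt_div ht0]
  set D := ENNReal.ofReal ((2 * (p / t) / (p / t - 1)) ^ (p / t)) with hD
  have hDt : D ≠ ∞ := ENNReal.ofReal_ne_top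
  have hD0 : D ≠ 0 := by
    have : 0 < (2 * (p / t) / (p / t - 1)) ^ (p / t) :=
      Real.rpow_pos_of_pos (div_pos (by linarith) (by linarith)) _
    simpa [hD] using this
  have hE : D ^ (1 / q) ≠ ∞ := ENNReal.rpow_ne_top_of_nonneg (by positivity) hDt
  have hE0 : D ^ (1 / q) ≠ 0 := by
    rw [Ne, ENNReal.rpow_eq_zero_iff]; simp [hD0, hDt]
  refine ⟨C * (D ^ (1 / q)).toNNReal, mul_pos hC0 (ENNReal.toNNReal_pos hE0 hE),
    fun w κ F hw hF hκ0 hκ hwκ => ?_⟩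
  rw [ENNReal.coe_mul, ENNReal.coe_toNNReal hE]
  set L := (∫⁻ x, F x ^ p) ^ (1 / p) with hL
  rcases eq_or_ne L ∞ with hLt | hLt
  · rw [hLt, ENNReal.mul_top]
    · exact le_top
    · exact mul_ne_zero (mul_ne_zero (by simpa using hC0.ne') hE0) hκ0
  rcases eq_or_ne L 0 with hL0 | hL0
  · have h0 : ∫⁻ x, F x ^ p = 0 := by
      rw [hL, ENNReal.rpow_eq_zero_iff] at hL0
      rcases hL0 with h | h
      · exact h.1
      · have : 0 < 1 / p := by positivity
        linarith [h.2]
    have h1 : F =ᵐ[volume] 0 := by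
      rw [lintegral_eq_zero_iff' (hF.pow_const p)] at h0
      filter_upwards [h0] with x hx
      simpa [hp0, hp0.not_gt] using hx
    have h2 : ∀ I, ∫⁻ y in dyadic I, w I y * F y = 0 := fun I => by
      have hm : AEMeasurable (fun y => w I y * F y) (volume.restrict (dyadic I)) :=
        ((hw I).mul hF).restrict
      rw [lintegral_eq_zero_iff' hm]
      filter_upwards [ae_restrict_of_ae h1] with x hx
      simp [hx]
    simp only [h2, fracSum, mul_zero, Set.indicator_zero, tsum_zero]
    simp [hq0]
  set m : ℝ → ℝ≥0∞ := fun x => (⨆ k : ℤ, lavg (fun y => F y ^ t) (idx k x)) ^ (1 / t) with hm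
  have hpt : ∀ x, fracSum α (fun I _ => ∫⁻ y in dyadic I, w I y * F y) x ≤
      κ * (C * (m x ^ (p / q) * L ^ (1 - p / q))) := fun x => by
    have h1 := hC (fun k => lavg (fun y => F y ^ t) (idx k x) ^ (1 / t)) (m x) L hL0 hLt
      (fun k => by
        simp only [hm]
        gcongr
        exact le_iSup (fun k : ℤ => lavg (fun y => F y ^ t) (idx k x)) k)
      (fun k => by
        have hj := lavg_rpow_le hr.le (F := fun y => F y ^ t) (I := idx k x)
          (hF.pow_const t).restrict
        simp only [← ENNReal.rpow_mul, mul_div_cancel₀ p ht0.ne'] at hj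
        have h2 : lavg (fun y => F y ^ t) (idx k x) ^ (1 / t) ≤
            lavg (fun y => F y ^ p) (idx k x) ^ (1 / p) := by
          calc _ = (lavg (fun y => F y ^ t) (idx k x) ^ (p / t)) ^ (1 / p) := by
                rw [← ENNReal.rpow_mul]; congr 1; field_simp
            _ ≤ _ := by gcongr
        refine h2.trans ?_
        rw [lavg, ENNReal.mul_rpow_of_nonneg _ _ (by positivity)]
        refine mul_le_mul' (le_of_eq ?_) ?_
        · have hl := len_pos (idx k x)
          rw [← ENNReal.ofReal_inv_of_pos hl, ENNReal.ofReal_rpow_of_pos (by positivity),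
            Real.inv_rpow hl.le, Real.rpow_neg (by positivity)]
          rfl
        · rw [hL]; gcongr; exact Measure.restrict_le_self)
    rw [fracSum_eq]
    refine le_trans ?_ (mul_le_mul_right h1 κ)
    rw [← ENNReal.tsum_mul_left]
    refine ENNReal.tsum_le_tsum fun k => ?_
    set I := idx k x with hI
    -- Hölder with exponents s and t turns the weight into the constant κ; the remaining averages
    -- are those fed to Hedberg's inequality.
    have h3 : ∫⁻ y in dyadic I, w I y * F y ≤
        ENNReal.ofReal (len I) * (κ * lavg (fun y => F y ^ t) I ^ (1 / t)) := by
      rw [← ofReal_len_mul_lavg]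
      gcongr
      refine (lavg_mul_le hst (hw I).restrict hF.restrict).trans ?_
      gcongr
      calc _ ≤ (κ ^ s) ^ (1 / s) := by
            have := hst.pos
            gcongr; exact hwκ I
        _ = κ := by rw [← ENNReal.rpow_mul, mul_one_div_cancel hst.ne_zero, ENNReal.rpow_one]
    refine (mul_le_mul_right h3 _).trans (le_of_eq ?_)
    have h4 : ENNReal.ofReal (len I ^ (-α)) * ENNReal.ofReal (len I) =
        ENNReal.ofReal (((2 : ℝ) ^ k) ^ (1 - α)) := by
      rw [← ENNReal.ofReal_mul (Real.rpow_nonneg (len_pos I).le _)]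
      congr 1
      conv_lhs => rw [← Real.rpow_one (len I), ← Real.rpow_mul (len_pos I).le]
      rw [one_mul, ← Real.rpow_add (len_pos I)]
      rw [neg_add_eq_sub]; rfl
    rw [← mul_assoc, h4]; ring
  have hmax := lintegral_maximal_le hr (hF.pow_const t)
  simp only [← ENNReal.rpow_mul, mul_div_cancel₀ p ht0.ne'] at hmax
  have hmm : ∀ x, m x ^ p = (⨆ k : ℤ, lavg (fun y => F y ^ t) (idx k x)) ^ (p / t) := fun x => by
    simp only [hm]; rw [← ENNReal.rpow_mul]; congr 1; field_simp
  have hLp : ∫⁻ x, F x ^ p = L ^ p := by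
    rw [hL, ← ENNReal.rpow_mul, one_div_mul_cancel hp0.ne', ENNReal.rpow_one]
  clear_value L m
  have hfin : ∫⁻ x, fracSum α (fun I _ => ∫⁻ y in dyadic I, w I y * F y) x ^ q ≤
      (κ * C) ^ q * (L ^ (q - p) * (D * L ^ p)) := by
    calc _ ≤ ∫⁻ x, (κ * C) ^ q * (L ^ (q - p) * m x ^ p) := by
          refine lintegral_mono fun x => ?_
          calc _ ≤ (κ * (C * (m x ^ (p / q) * L ^ (1 - p / q)))) ^ q := by gcongr; exact hpt x
            _ = _ := by
              rw [← mul_assoc, ENNReal.mul_rpow_of_nonneg _ _ hq0.le,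
                ENNReal.mul_rpow_of_nonneg (m x ^ _) _ hq0.le, ← ENNReal.rpow_mul, ← ENNReal.rpow_mul,
                div_mul_cancel₀ _ hq0.ne', show (1 - p / q) * q = q - p by field_simp,
                mul_comm (m x ^ p)]
      _ = (κ * C) ^ q * (L ^ (q - p) * ∫⁻ x, m x ^ p) := by
          rw [lintegral_const_mul' _ _ (ENNReal.rpow_ne_top_of_nonneg hq0.le
            (ENNReal.mul_ne_top hκ ENNReal.coe_ne_top)),
            lintegral_const_mul' _ _ (ENNReal.rpow_ne_top_of_nonneg (by linarith) hLt)]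
      _ ≤ _ := by
          gcongr
          simp only [hmm]
          exact hmax.trans_eq (by rw [hLp])
  calc _ ≤ ((κ * C) ^ q * (L ^ (q - p) * (D * L ^ p))) ^ (1 / q) := by gcongr
    _ = _ := by
      rw [mul_left_comm (L ^ (q - p)), ← ENNReal.rpow_add _ _ hL0 hLt, sub_add_cancel,
        ENNReal.mul_rpow_of_nonneg _ _ (by positivity : 0 ≤ 1 / q),
        ENNReal.mul_rpow_of_nonneg D _ (by positivity : 0 ≤ 1 / q), ← ENNReal.rpow_mul,
        ← ENNReal.rpow_mul, mul_one_div_cancel hq0.ne', ENNReal.rpow_one, ENNReal.rpow_one]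
      ring

/-- The converse of Hölder's inequality. -/
lemma lintegral_rpow_le_of_dual {p q : ℝ} (hpq : p.HolderConjugate q) {H : ℝ → ℝ≥0∞}
    (hH : AEMeasurable H volume) {A : ℝ≥0∞}
    (h : ∀ G : ℝ → ℝ≥0∞, AEMeasurable G volume →
      ∫⁻ x, G x * H x ≤ A * (∫⁻ x, G x ^ q) ^ (1 / q)) :
    (∫⁻ x, H x ^ p) ^ (1 / p) ≤ A := by
  have hp0 : 0 < p := hpq.pos
  have hp1 : 0 < p - 1 := by linarith [hpq.lt]
  -- Truncating in height and support makes ∫ T^p finite, so that a power of it can be cancelled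
  -- after testing on G = T^(p-1).
  set T : ℕ → ℝ → ℝ≥0∞ := fun n => (Set.Icc (-(n : ℝ)) n).indicator fun x => min (H x) n with hT
  have hTm : ∀ n, AEMeasurable (T n) volume := fun n =>
    (hH.min aemeasurable_const).indicator measurableSet_Icc
  have hTH : ∀ n x, T n x ≤ H x := fun n x =>
    Set.indicator_apply_le' (fun _ => min_le_left _ _) fun _ => zero_le
  have hTn : ∀ n x, T n x ≤ n := fun n x =>
    Set.indicator_apply_le' (fun _ => min_le_right _ _) fun _ => zero_le
  have key : ∀ n, ∫⁻ x, T n x ^ p ≤ A ^ p := fun n => by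
    set X := ∫⁻ x, T n x ^ p with hX
    have hXt : X ≠ ∞ := by
      have : X ≤ ∫⁻ x, (Set.Icc (-(n : ℝ)) n).indicator (fun _ => (n : ℝ≥0∞) ^ p) x := by
        refine lintegral_mono fun x => ?_
        by_cases hx : x ∈ Set.Icc (-(n : ℝ)) n
        · rw [Set.indicator_of_mem hx]
          gcongr; exact hTn n x
        · simp [hT, Set.indicator_of_notMem hx, hp0]
      refine ne_top_of_le_ne_top ?_ this
      rw [lintegral_indicator measurableSet_Icc, setLIntegral_const]
      exact ENNReal.mul_ne_top (ENNReal.rpow_ne_top_of_nonneg hp0.le (by simp)) (by simp)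
    have h1 := h (fun x => T n x ^ (p - 1)) ((hTm n).pow_const _)
    have h2 : X ≤ ∫⁻ x, T n x ^ (p - 1) * H x := by
      refine lintegral_mono fun x => ?_
      calc T n x ^ p = T n x ^ (p - 1) * T n x := by
            conv_rhs => rw [← ENNReal.rpow_one (T n x), ← ENNReal.rpow_mul]
            rw [one_mul, ← ENNReal.rpow_add_of_nonneg _ _ hp1.le zero_le_one, sub_add_cancel]
        _ ≤ _ := by gcongr; exact hTH n x
    simp only [← ENNReal.rpow_mul, hpq.sub_one_mul_conj] at h1
    rw [← hX] at h1
    have h3 : X ≤ A * X ^ (1 / q) := h2.trans h1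
    rcases eq_or_ne X 0 with hX0 | hX0
    · rw [hX0]; exact zero_le
    have h4 : X ^ (1 / p) * X ^ (1 / q) = X := by
      rw [← ENNReal.rpow_add _ _ hX0 hXt]
      simp only [one_div, hpq.inv_add_inv_eq_one, ENNReal.rpow_one]
    have h5 : X ^ (1 / p) ≤ A := by
      rw [← h4] at h3
      have hq1 : (0 : ℝ) ≤ 1 / q := by have := hpq.symm.pos; positivity
      have hy0 : X ^ (1 / q) ≠ 0 := by rw [Ne, ENNReal.rpow_eq_zero_iff]; simp [hX0, hXt]
      have hyt : X ^ (1 / q) ≠ ∞ := ENNReal.rpow_ne_top_of_nonneg hq1 hXt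
      rw [h4] at h3
      conv_lhs at h3 => rw [← h4]
      exact (ENNReal.mul_le_mul_iff_left hy0 hyt).1 h3
    calc X = (X ^ (1 / p)) ^ p := by
          rw [← ENNReal.rpow_mul, one_div_mul_cancel hp0.ne', ENNReal.rpow_one]
      _ ≤ A ^ p := by gcongr
  have hlim : ∀ x, H x ^ p ≤ Filter.liminf (fun n => T n x ^ p) Filter.atTop := fun x => by
    have h1 : Filter.Tendsto (fun n : ℕ => min (H x) (n : ℝ≥0∞)) Filter.atTop
        (nhds (min (H x) ∞)) :=
      tendsto_const_nhds.min ENNReal.tendsto_nat_nhds_top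
    rw [min_eq_left le_top] at h1
    have h2 : Filter.Tendsto (fun n => T n x) Filter.atTop (nhds (H x)) := by
      refine h1.congr' ?_
      filter_upwards [Filter.eventually_ge_atTop ⌈|x|⌉₊] with n hn
      have : |x| ≤ n := (Nat.le_ceil _).trans (by exact_mod_cast hn)
      rw [hT]
      simp only
      rw [Set.indicator_of_mem]
      exact abs_le.1 this
    exact ((h2.ennrpow_const p).liminf_eq).ge
  have hfin : ∫⁻ x, H x ^ p ≤ A ^ p :=
    (lintegral_mono hlim).trans ((lintegral_liminf_le' fun n => (hTm n).pow_const p).trans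
      (Filter.liminf_le_of_frequently_le' (Filter.Frequently.of_forall key)))
  calc _ ≤ (A ^ p) ^ (1 / p) := by gcongr
    _ = A := by rw [← ENNReal.rpow_mul, mul_one_div_cancel hp0.ne', ENNReal.rpow_one]

/-- Boundedness of `F ↦ ∑_I |I|^(-α) w_I ⟨F⟩ 1_I` from `L^p` to `L^q`, by duality. -/
lemma fracSum_weight_bound {α p q s : ℝ} (hp : 1 < p) (hpq : p < q)
    (hαpq : 1 - α + 1 / q = 1 / p) (hs : 1 < s) (hsq : s.conjExponent < q.conjExponent) :
    ∃ C : ℝ≥0, 0 < C ∧ ∀ (w : ℤ × ℤ → ℝ → ℝ≥0∞) (κ : ℝ≥0∞) (F : ℝ → ℝ≥0∞),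
      (∀ I, AEMeasurable (w I) volume) → AEMeasurable F volume → κ ≠ 0 → κ ≠ ∞ →
      (∀ I, lavg (fun x => w I x ^ s) I ≤ κ ^ s) →
      (∫⁻ x, fracSum α (fun I x => w I x * ∫⁻ y in dyadic I, F y) x ^ q) ^ (1 / q) ≤
        C * κ * (∫⁻ x, F x ^ p) ^ (1 / p) := by
  have hpc := Real.HolderConjugate.conjExponent hp
  have hqc := Real.HolderConjugate.conjExponent (hp.trans hpq)
  have h1 := hpc.inv_add_inv_eq_one
  have h2 := hqc.inv_add_inv_eq_one
  set p' := p.conjExponent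
  set q' := q.conjExponent
  rw [one_div, one_div] at hαpq
  have hlt : q' < p' := by
    have : q⁻¹ < p⁻¹ := inv_strictAnti₀ (by linarith) hpq
    exact (inv_lt_inv₀ hpc.symm.pos hqc.symm.pos).1 (by linarith)
  -- The transpose maps L^(q') to L^(p'), and 1 - α + 1/p' = 1/q' is the same scaling relation.
  obtain ⟨C, hC0, hC⟩ := fracSum_integral_bound (α := α) (s := s) hqc.symm.lt hlt
    (by rw [one_div, one_div]; linarith) hs hsq
  refine ⟨C, hC0, fun w κ F hw hF hκ0 hκ hwκ => ?_⟩
  have hc1 : ∀ I, AEMeasurable (fun x => w I x * ∫⁻ y in dyadic I, F y) volume :=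
    fun I => (hw I).mul_const _
  refine lintegral_rpow_le_of_dual hqc (aemeasurable_fracSum α hc1) fun G hG => ?_
  have hc2 : ∀ I, AEMeasurable (fun _ : ℝ => ∫⁻ y in dyadic I, w I y * G y) volume :=
    fun I => aemeasurable_const
  have hdual : ∫⁻ x, G x * fracSum α (fun I x => w I x * ∫⁻ y in dyadic I, F y) x =
      ∫⁻ x, F x * fracSum α (fun I _ => ∫⁻ y in dyadic I, w I y * G y) x := by
    rw [lintegral_mul_fracSum α hc1 hG, lintegral_mul_fracSum α hc2 hF]
    refine tsum_congr fun I => ?_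
    congr 1
    have hm : AEMeasurable (fun y => w I y * G y) (volume.restrict (dyadic I)) :=
      ((hw I).mul hG).restrict
    rw [lintegral_const_mul'' _ hF.restrict, ← lintegral_mul_const'' _ hm]
    refine lintegral_congr fun x => ?_
    ring
  rw [hdual]
  refine (ENNReal.lintegral_mul_le_Lp_mul_Lq volume hpc hF (aemeasurable_fracSum α hc2)).trans ?_
  refine (mul_le_mul_right (hC w κ G hw hG hκ0 hκ hwκ) _).trans (le_of_eq ?_)
  ring

/-! ### The upper bound -/

/-- John–Nirenberg is available for integer moments, so the Hölder exponent is a large integer N,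
whose conjugate is close to 1. -/
lemma exists_conjExponent_lt {r : ℝ} (hr : 1 < r) :
    ∃ N : ℕ, 1 < (N : ℝ) ∧ (N : ℝ).conjExponent < r := by
  obtain ⟨N, hN⟩ := exists_nat_gt (max 1 (r / (r - 1)))
  have h1 : (1 : ℝ) < N := (le_max_left _ _).trans_lt hN
  have h2 : r / (r - 1) < N := (le_max_right _ _).trans_lt hN
  refine ⟨N, h1, ?_⟩
  rw [div_lt_iff₀ (by linarith)] at h2
  rw [Real.conjExponent, div_lt_iff₀ (by linarith)]
  linarith

lemma lavg_enorm_sub_avg_le {b : ℝ → 𝕜} (hb : LocallyIntegrable b volume) {B : ℝ}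
    (hB0 : 0 < B) (hB : bmoNorm b ≤ ENNReal.ofReal B) {N : ℕ} (hN : N ≠ 0) (I : ℤ × ℤ) :
    lavg (fun x => ‖b x - avg b I‖ₑ ^ (N : ℝ)) I ≤
      ENNReal.ofReal (10 * B * (N.factorial * 8)) ^ (N : ℝ) := by
  have hl := len_pos I
  have h := lintegral_norm_sub_avg_pow_le hb hB0 hB N I
  have h1 : (1 : ℝ) ≤ N.factorial := by exact_mod_cast N.factorial_pos
  -- Writing the whole bound as an N-th power puts it in the form κ^s used for the weights.
  have h2 : (N.factorial * 8 : ℝ) ≤ (N.factorial * 8 : ℝ) ^ N := le_self_pow₀ (by linarith) hN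
  simp only [ENNReal.rpow_natCast, lavg]
  rw [← ENNReal.ofReal_pow (by positivity), mul_comm, ← div_eq_mul_inv,
    ENNReal.div_le_iff (ofReal_len_ne_zero I) ENNReal.ofReal_ne_top,
    ← ENNReal.ofReal_mul (by positivity)]
  refine h.trans (ENNReal.ofReal_le_ofReal ?_)
  rw [mul_pow (10 * B), mul_assoc ((10 * B) ^ N)]
  gcongr

/-- The two positive operators whose sum dominates the commutator are bounded, and so is the
positive dyadic Riesz potential. -/
lemma exists_positive_bounds {α p q : ℝ} (hp : 1 < p) (hpq : p < q)
    (hαpq : 1 - α + 1 / q = 1 / p) :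
    ∃ C : ℝ≥0, 0 < C ∧ ∀ (b : ℝ → 𝕜), LocallyIntegrable b volume →
      ∀ B : ℝ, 0 < B → bmoNorm b ≤ ENNReal.ofReal B → ∀ F : ℝ → ℝ≥0∞, AEMeasurable F volume →
      (∫⁻ x, fracSum α (fun I _ => ∫⁻ y in dyadic I, F y) x ^ q) ^ (1 / q) ≤
        C * (∫⁻ x, F x ^ p) ^ (1 / p) ∧
      (∫⁻ x, fracSum α (fun I _ => ∫⁻ y in dyadic I, ‖b y - avg b I‖ₑ * F y) x ^ q) ^ (1 / q) ≤
        C * ENNReal.ofReal B * (∫⁻ x, F x ^ p) ^ (1 / p) ∧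
      (∫⁻ x, fracSum α (fun I x => ‖b x - avg b I‖ₑ * ∫⁻ y in dyadic I, F y) x ^ q) ^ (1 / q) ≤
        C * ENNReal.ofReal B * (∫⁻ x, F x ^ p) ^ (1 / p) := by
  have hq : 1 < q := hp.trans hpq
  -- N' < p serves the inner weight and N' < q' the outer one.
  obtain ⟨N, hN1, hN⟩ := exists_conjExponent_lt
    (lt_min hp (Real.HolderConjugate.conjExponent hq).symm.lt)
  obtain ⟨C₁, hC₁, h₁⟩ := fracSum_integral_bound hp hpq hαpq hN1 (hN.trans_le (min_le_left _ _))
  obtain ⟨C₂, hC₂, h₂⟩ := fracSum_weight_bound hp hpq hαpq hN1 (hN.trans_le (min_le_right _ _))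
  have hN0 : N ≠ 0 := by rintro rfl; norm_num at hN1
  set M : ℝ≥0 := 10 * (N.factorial * 8) with hM
  have hM1 : 1 ≤ M := by
    have h1 : (1 : ℝ≥0) ≤ N.factorial := by exact_mod_cast N.factorial_pos
    calc (1 : ℝ≥0) ≤ 10 * (1 * 8) := by norm_num
      _ ≤ M := by rw [hM]; gcongr
  refine ⟨(C₁ + C₂) * M, by positivity, fun b hb B hB0 hB F hF => ?_⟩
  have hκ0 : ENNReal.ofReal (10 * B * (N.factorial * 8)) ≠ 0 := by
    have : 0 < 10 * B * (N.factorial * 8) := by positivity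
    simpa using this
  have hκ : ENNReal.ofReal (10 * B * (N.factorial * 8)) = M * ENNReal.ofReal B := by
    rw [← ENNReal.ofReal_coe_nnreal, ← ENNReal.ofReal_mul (by positivity), hM]
    congr 1; push_cast; ring
  have hw : ∀ I, AEMeasurable (fun x => ‖b x - avg b I‖ₑ) volume := fun I =>
    (hb.aestronglyMeasurable.aemeasurable.sub_const _).enorm
  have hJN := fun I => lavg_enorm_sub_avg_le hb hB0 hB hN0 I
  clear_value M
  refine ⟨?_, ?_, ?_⟩
  · have := h₁ (fun _ _ => 1) 1 F (fun _ => aemeasurable_const) hF one_ne_zero ENNReal.one_ne_top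
      (fun I => by simp [lavg_const])
    simp only [one_mul, mul_one] at this
    refine this.trans ?_
    gcongr
    calc C₁ ≤ C₁ + C₂ := le_self_add
      _ ≤ _ := le_mul_of_one_le_right zero_le hM1
  · refine (h₁ (fun I x => ‖b x - avg b I‖ₑ) _ F hw hF hκ0 ENNReal.ofReal_ne_top hJN).trans ?_
    rw [hκ, ← mul_assoc, ENNReal.coe_mul]
    gcongr
    exact_mod_cast (le_self_add : C₁ ≤ C₁ + C₂)
  · refine (h₂ (fun I x => ‖b x - avg b I‖ₑ) _ F hw hF hκ0 ENNReal.ofReal_ne_top hJN).trans ?_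
    rw [hκ, ← mul_assoc, ENNReal.coe_mul]
    gcongr
    exact_mod_cast (le_add_self : C₂ ≤ C₁ + C₂)

lemma riesz_eq_tsum (α : ℝ) (f : ℝ → 𝕜) (x : ℝ) :
    riesz α f x = ∑' k : ℤ, len (idx k x) ^ (-α) • ∫ y in dyadic (idx k x), f y :=
  tsum_indicator_dyadic (fun I => len I ^ (-α) • ∫ y in dyadic I, f y) x

lemma enorm_riesz_term_le (α : ℝ) (g : ℝ → 𝕜) (I : ℤ × ℤ) :
    ‖len I ^ (-α) • ∫ y in dyadic I, g y‖ₑ ≤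
      ENNReal.ofReal (len I ^ (-α)) * ∫⁻ y in dyadic I, ‖g y‖ₑ := by
  rw [enorm_smul, Real.enorm_of_nonneg (Real.rpow_nonneg (len_pos I).le _)]
  gcongr
  exact enorm_integral_le_lintegral_enorm _

lemma summable_riesz {α : ℝ} {g : ℝ → 𝕜} {x : ℝ}
    (h : fracSum α (fun I _ => ∫⁻ y in dyadic I, ‖g y‖ₑ) x < ∞) :
    Summable fun k : ℤ => len (idx k x) ^ (-α) • ∫ y in dyadic (idx k x), g y := by
  rw [fracSum_eq] at h
  exact Summable.of_enorm
    (ne_top_of_le_ne_top h.ne (ENNReal.tsum_le_tsum fun k => enorm_riesz_term_le α g _))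

/-- A finite sum has finite terms, and the coefficients |I|^(-α) do not vanish. -/
lemma integrableOn_of_fracSum_lt_top {α : ℝ} {g : ℝ → 𝕜} (hg : AEStronglyMeasurable g volume)
    {x : ℝ} (h : fracSum α (fun I _ => ∫⁻ y in dyadic I, ‖g y‖ₑ) x < ∞) (k : ℤ) :
    IntegrableOn g (dyadic (idx k x)) volume := by
  refine ⟨hg.restrict, ?_⟩
  rw [fracSum_eq] at h
  have h1 := ENNReal.ne_top_of_tsum_ne_top h.ne k
  have h2 : ENNReal.ofReal (len (idx k x) ^ (-α)) ≠ 0 := by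
    simpa using Real.rpow_pos_of_pos (len_pos _) _
  refine lt_top_iff_ne_top.2 fun h3 => h1 ?_
  change ∫⁻ y in dyadic (idx k x), ‖g y‖ₑ = ∞ at h3
  rw [h3, ENNReal.mul_top h2]

/-- Writes b(y) = (b(y) - b_I) - (b(x) - b_I) + b(x). Each resulting sum is finite almost
everywhere, which makes I_α(bf) well defined. -/
lemma fracSum_mulOp_le {α : ℝ} {b f : ℝ → 𝕜} (hb : AEStronglyMeasurable b volume)
    (hf : AEStronglyMeasurable f volume) (x : ℝ) :
    fracSum α (fun I _ => ∫⁻ y in dyadic I, ‖mulOp b f y‖ₑ) x ≤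
      fracSum α (fun I _ => ∫⁻ y in dyadic I, ‖b y - avg b I‖ₑ * ‖f y‖ₑ) x +
      fracSum α (fun I x => ‖b x - avg b I‖ₑ * ∫⁻ y in dyadic I, ‖f y‖ₑ) x +
      ‖b x‖ₑ * fracSum α (fun I _ => ∫⁻ y in dyadic I, ‖f y‖ₑ) x := by
  simp only [fracSum_eq]
  rw [← ENNReal.tsum_mul_left, ← ENNReal.tsum_add, ← ENNReal.tsum_add]
  refine ENNReal.tsum_le_tsum fun k => ?_
  set I := idx k x
  have h1 : ∀ y, ‖mulOp b f y‖ₑ ≤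
      ‖b y - avg b I‖ₑ * ‖f y‖ₑ + (‖b x - avg b I‖ₑ + ‖b x‖ₑ) * ‖f y‖ₑ := fun y => by
    rw [mulOp, enorm_mul, ← add_mul]
    gcongr
    calc ‖b y‖ₑ = ‖(b y - avg b I) + (b x - (b x - avg b I))‖ₑ := by congr 1; ring
      _ ≤ ‖b y - avg b I‖ₑ + ‖b x - (b x - avg b I)‖ₑ := enorm_add_le _ _
      _ ≤ ‖b y - avg b I‖ₑ + (‖b x‖ₑ + ‖b x - avg b I‖ₑ) := by gcongr; exact enorm_sub_le
      _ = _ := by ring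
  have h2 : ∫⁻ y in dyadic I, ‖mulOp b f y‖ₑ ≤ (∫⁻ y in dyadic I, ‖b y - avg b I‖ₑ * ‖f y‖ₑ) +
      (‖b x - avg b I‖ₑ + ‖b x‖ₑ) * ∫⁻ y in dyadic I, ‖f y‖ₑ := by
    refine (lintegral_mono h1).trans (le_of_eq ?_)
    have hm : AEMeasurable (fun y => ‖b y - avg b I‖ₑ * ‖f y‖ₑ) (volume.restrict (dyadic I)) :=
      ((hb.aemeasurable.sub_const _).enorm.mul hf.aemeasurable.enorm).restrict
    rw [lintegral_add_left' hm, lintegral_const_mul' _ _ (by simp)]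
  refine (mul_le_mul_right h2 _).trans (le_of_eq ?_)
  ring

lemma enorm_commutator_le {α : ℝ} {b f : ℝ → 𝕜} (hb : AEStronglyMeasurable b volume)
    (hf : AEStronglyMeasurable f volume) {x : ℝ}
    (h1 : fracSum α (fun I _ => ∫⁻ y in dyadic I, ‖f y‖ₑ) x < ∞)
    (h2 : fracSum α (fun I _ => ∫⁻ y in dyadic I, ‖mulOp b f y‖ₑ) x < ∞) :
    ‖commutator (mulOp b) (riesz α) f x‖ₑ ≤
      fracSum α (fun I _ => ∫⁻ y in dyadic I, ‖b y - avg b I‖ₑ * ‖f y‖ₑ) x +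
      fracSum α (fun I x => ‖b x - avg b I‖ₑ * ∫⁻ y in dyadic I, ‖f y‖ₑ) x := by
  have e : commutator (mulOp b) (riesz α) f x =
      ∑' k : ℤ, len (idx k x) ^ (-α) • ∫ y in dyadic (idx k x), (b x - b y) * f y := by
    have : ∀ k : ℤ, len (idx k x) ^ (-α) • ∫ y in dyadic (idx k x), (b x - b y) * f y =
        b x * (len (idx k x) ^ (-α) • ∫ y in dyadic (idx k x), f y) -
          len (idx k x) ^ (-α) • ∫ y in dyadic (idx k x), mulOp b f y := fun k => by
      have hi1 := integrableOn_of_fracSum_lt_top hf h1 k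
      have hi2 : IntegrableOn (mulOp b f) (dyadic (idx k x)) volume :=
        integrableOn_of_fracSum_lt_top (hb.mul hf) h2 k
      rw [mul_smul_comm, ← smul_sub, ← integral_const_mul, ← integral_sub (hi1.const_mul _) hi2]
      simp only [mulOp, sub_mul]
    simp only [this]
    rw [((summable_riesz h1).mul_left (b x)).tsum_sub (summable_riesz h2), tsum_mul_left,
      ← riesz_eq_tsum, ← riesz_eq_tsum]
    rfl
  rw [e]
  refine enorm_tsum_le_tsum_enorm.trans ?_
  simp only [fracSum_eq]
  rw [← ENNReal.tsum_add]
  refine ENNReal.tsum_le_tsum fun k => ?_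
  set I := idx k x
  refine (enorm_riesz_term_le α _ I).trans ?_
  rw [← mul_add]
  gcongr
  have hm : AEMeasurable (fun y => ‖b y - avg b I‖ₑ * ‖f y‖ₑ) (volume.restrict (dyadic I)) :=
    ((hb.aemeasurable.sub_const _).enorm.mul hf.aemeasurable.enorm).restrict
  rw [← lintegral_const_mul' _ _ (by simp), ← lintegral_add_left' hm]
  refine lintegral_mono fun y => ?_
  rw [enorm_mul, ← add_mul]
  gcongr
  calc ‖b x - b y‖ₑ = ‖(b x - avg b I) - (b y - avg b I)‖ₑ := by congr 1; ring
    _ ≤ ‖b x - avg b I‖ₑ + ‖b y - avg b I‖ₑ := enorm_sub_le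
    _ = _ := add_comm _ _

lemma eLpNorm_ofReal_eq {p : ℝ} (hp : 0 < p) {E : Type*} [NormedAddCommGroup E] (f : ℝ → E)
    (μ : Measure ℝ) :
    eLpNorm f (ENNReal.ofReal p) μ = (∫⁻ x, ‖f x‖ₑ ^ p ∂μ) ^ (1 / p) := by
  rw [eLpNorm_eq_lintegral_rpow_enorm_toReal (by simpa using hp) ENNReal.ofReal_ne_top,
    ENNReal.toReal_ofReal hp.le]

lemma ae_lt_top_of_Lp {q : ℝ} (hq : 0 < q) {T : ℝ → ℝ≥0∞} (hT : AEMeasurable T volume)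
    {A : ℝ≥0∞} (hA : A ≠ ∞) (h : (∫⁻ x, T x ^ q) ^ (1 / q) ≤ A) : ∀ᵐ x : ℝ, T x < ∞ := by
  have h1 : ∫⁻ x, T x ^ q ≠ ∞ := fun h2 => by
    rw [h2, ENNReal.top_rpow_of_pos (by positivity)] at h
    exact hA (top_le_iff.1 h)
  filter_upwards [ae_lt_top' (hT.pow_const q) h1] with x hx
  exact (ENNReal.rpow_lt_top_iff_of_pos hq).1 hx

/-- The upper bound for the commutator, together with the fact that its domain is all of `L^p`. -/
theorem commutator_upper_bound {α p q : ℝ} (hp : 1 < p) (hpq : p < q)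
    (hαpq : 1 - α + 1 / q = 1 / p) :
    ∃ C : ℝ≥0, 0 < C ∧ ∀ (b : ℝ → 𝕜), LocallyIntegrable b volume →
      ∀ B : ℝ, 0 < B → bmoNorm b ≤ ENNReal.ofReal B →
      ∀ f : ℝ → 𝕜, MemLp f (ENNReal.ofReal p) volume →
        CommDomain α p b f ∧
        eLpNorm (commutator (mulOp b) (riesz α) f) (ENNReal.ofReal q) volume ≤
          C * ENNReal.ofReal B * eLpNorm f (ENNReal.ofReal p) volume := by
  obtain ⟨C, hC0, hC⟩ := exists_positive_bounds (𝕜 := 𝕜) hp hpq hαpq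
  refine ⟨C + C, by positivity, fun b hb B hB0 hB f hf => ?_⟩
  have hp0 : 0 < p := by linarith
  have hq0 : 0 < q := by linarith
  have hbm := hb.aestronglyMeasurable
  have hfm := hf.1
  have hF : AEMeasurable (fun x => ‖f x‖ₑ) volume := hfm.aemeasurable.enorm
  have hw : ∀ I, AEMeasurable (fun x => ‖b x - avg b I‖ₑ) volume := fun I =>
    (hbm.aemeasurable.sub_const _).enorm
  obtain ⟨b0, b2, b1⟩ := hC b hb B hB0 hB _ hF
  rw [← eLpNorm_ofReal_eq hp0] at b0 b1 b2
  have hfin : eLpNorm f (ENNReal.ofReal p) volume ≠ ∞ := hf.2.ne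
  have m0 : AEMeasurable (fracSum α (fun I _ => ∫⁻ y in dyadic I, ‖f y‖ₑ)) volume :=
    aemeasurable_fracSum α fun I => aemeasurable_const
  have m2 : AEMeasurable (fracSum α
      (fun I _ => ∫⁻ y in dyadic I, ‖b y - avg b I‖ₑ * ‖f y‖ₑ)) volume :=
    aemeasurable_fracSum α fun I => aemeasurable_const
  have m1 : AEMeasurable (fracSum α
      (fun I x => ‖b x - avg b I‖ₑ * ∫⁻ y in dyadic I, ‖f y‖ₑ)) volume :=
    aemeasurable_fracSum α fun I => (hw I).mul_const _
  have f0 := ae_lt_top_of_Lp hq0 m0 (ENNReal.mul_ne_top ENNReal.coe_ne_top hfin) b0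
  have hA : C * ENNReal.ofReal B * eLpNorm f (ENNReal.ofReal p) volume ≠ ∞ :=
    ENNReal.mul_ne_top (ENNReal.mul_ne_top ENNReal.coe_ne_top ENNReal.ofReal_ne_top) hfin
  have f1 := ae_lt_top_of_Lp hq0 m1 hA b1
  have f2 := ae_lt_top_of_Lp hq0 m2 hA b2
  have f3 : ∀ᵐ x, fracSum α (fun I _ => ∫⁻ y in dyadic I, ‖mulOp b f y‖ₑ) x < ∞ := by
    filter_upwards [f0, f1, f2] with x h0 h1 h2
    exact (fracSum_mulOp_le hbm hfm x).trans_lt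
      (ENNReal.add_lt_top.2 ⟨ENNReal.add_lt_top.2 ⟨h2, h1⟩, ENNReal.mul_lt_top (by simp) h0⟩)
  refine ⟨⟨hf, ⟨hfm, f0⟩, ⟨hbm.mul hfm, f3⟩⟩, ?_⟩
  rw [eLpNorm_ofReal_eq hq0]
  calc _ ≤ (∫⁻ x, (fracSum α (fun I _ => ∫⁻ y in dyadic I, ‖b y - avg b I‖ₑ * ‖f y‖ₑ) +
      fracSum α (fun I x => ‖b x - avg b I‖ₑ * ∫⁻ y in dyadic I, ‖f y‖ₑ)) x ^ q) ^ (1 / q) := by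
        gcongr ?_ ^ (1 / q)
        refine lintegral_mono_ae ?_
        filter_upwards [f0, f3] with x h0 h3
        gcongr
        exact enorm_commutator_le hbm hfm h0 h3
    _ ≤ _ := ENNReal.lintegral_Lp_add_le m2 m1 (by linarith)
    _ ≤ _ := add_le_add b2 b1
    _ = _ := by rw [ENNReal.coe_add]; ring

/-! ### Orthonormality of the Haar functions -/

lemma haar_eq_zero {I : ℤ × ℤ} {x : ℝ} (hx : x ∉ dyadic I) : haar I x = 0 := by
  have h1 : x ∉ dyadic (leftHalf I) := fun h => hx (dyadic_leftHalf_subset I h)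
  have h2 : x ∉ dyadic (rightHalf I) := fun h => hx (dyadic_rightHalf_subset I h)
  simp [haar, h1, h2]

/-- An interval strictly below K lies inside one half of K or misses both; this constancy is the
source of orthogonality across levels. -/
lemma haar_eq_of_mem {I K : ℤ × ℤ} (h : I.2 < K.2) {x y : ℝ} (hx : x ∈ dyadic I)
    (hy : y ∈ dyadic I) : haar K x = haar K y := by
  rw [mem_dyadic_iff] at hx hy
  have hxy : idx I.2 x = idx I.2 y := hx.trans hy.symm
  have e : ∀ M : ℤ × ℤ, I.2 ≤ M.2 → (x ∈ dyadic M ↔ y ∈ dyadic M) := fun M hM => by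
    rw [mem_dyadic_iff, mem_dyadic_iff, idx_ancestor hM hxy]
  have h1 := e (leftHalf K) (by simp only [leftHalf]; omega)
  have h2 := e (rightHalf K) (by simp only [rightHalf]; omega)
  by_cases k1 : y ∈ dyadic (leftHalf K) <;> by_cases k2 : y ∈ dyadic (rightHalf K) <;>
    simp [haar, h1, h2, k1, k2]

lemma integral_haar (I : ℤ × ℤ) : ∫ x, haar I x = 0 := by
  -- The integral is the Haar coefficient of the constant 1.
  have h := haarCoeff_eq (𝕜 := ℝ) (b := fun _ => 1) (locallyIntegrable_const 1) I
  simp only [haarCoeff, smul_eq_mul, mul_one, setIntegral_const, volume_real_dyadic, len_leftHalf,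
    len_rightHalf, sub_self, mul_zero] at h
  exact h

lemma integral_haar_mul_of_lt {I K : ℤ × ℤ} (h : I.2 < K.2) : ∫ x, haar I x * haar K x = 0 := by
  obtain ⟨y, hy⟩ := nonempty_dyadic I
  have : ∀ x, haar I x * haar K x = haar I x * haar K y := fun x => by
    by_cases hx : x ∈ dyadic I
    · rw [haar_eq_of_mem h hx hy]
    · rw [haar_eq_zero hx, zero_mul, zero_mul]
  simp only [this]
  rw [integral_mul_const, integral_haar, zero_mul]

lemma integral_haar_mul (I K : ℤ × ℤ) : ∫ x, haar I x * haar K x = if I = K then 1 else 0 := by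
  split_ifs with h
  · subst h
    have : ∀ x, haar I x * haar I x = (dyadic I).indicator (fun _ => (len I)⁻¹) x := fun x => by
      have hl : len I ^ (-(1 / 2) : ℝ) * len I ^ (-(1 / 2) : ℝ) = (len I)⁻¹ := by
        rw [← Real.rpow_add (len_pos I), ← Real.rpow_neg_one]; norm_num
      by_cases hx : x ∈ dyadic I
      · rw [Set.indicator_of_mem hx, ← hl]
        rcases (dyadic_halves_union I).symm ▸ hx with h1 | h2
        · have h2 := Set.disjoint_left.1 (disjoint_halves I) h1
          simp [haar, h1, h2]
        · have h1 := Set.disjoint_right.1 (disjoint_halves I) h2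
          simp [haar, h1, h2]
      · rw [Set.indicator_of_notMem hx, haar_eq_zero hx, zero_mul]
    simp only [this]
    rw [integral_indicator (measurableSet_dyadic I), setIntegral_const, volume_real_dyadic,
      smul_eq_mul, mul_inv_cancel₀ (len_pos I).ne']
  · rcases lt_trichotomy I.2 K.2 with hlt | heq | hgt
    · exact integral_haar_mul_of_lt hlt
    · have : ∀ x, haar I x * haar K x = 0 := fun x => by
        by_cases hx : x ∈ dyadic I
        · rw [haar_eq_zero (Set.disjoint_left.1 (disjoint_dyadic_of_ne heq h) hx), mul_zero]
        · rw [haar_eq_zero hx, zero_mul]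
      simp [this]
    · simp only [mul_comm (haar I _)]
      exact integral_haar_mul_of_lt hgt

lemma memLp_haar_smul (I : ℤ × ℤ) (z : 𝕜) (p : ℝ≥0∞) :
    MemLp (fun x => haar I x • z) p volume := by
  have h : ∀ x, haar I x • z = _ := fun x => haar_smul I (fun _ => z) x
  simp only [h]
  exact ((memLp_indicator_const p (measurableSet_dyadic _) z
    (Or.inr (volume_dyadic_ne_top _))).sub (memLp_indicator_const p (measurableSet_dyadic _) z
    (Or.inr (volume_dyadic_ne_top _)))).const_smul _

lemma integrable_haar_mul (I K : ℤ × ℤ) : Integrable (fun x => haar I x * haar K x) volume := by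
  have h := fun I => memLp_haar_smul (𝕜 := ℝ) I 1 2
  simp only [smul_eq_mul, mul_one] at h
  exact (h I).integrable_mul (h K)

/-- The dual test function `∑_{I ∈ F} conj ⟨b, h_I⟩ h_I`. -/
def haarSum (b : ℝ → 𝕜) (F : Finset (ℤ × ℤ)) (x : ℝ) : 𝕜 :=
  ∑ I ∈ F, haar I x • (starRingEnd 𝕜) (haarCoeff b I)

lemma memLp_haarSum (b : ℝ → 𝕜) (F : Finset (ℤ × ℤ)) (p : ℝ≥0∞) :
    MemLp (haarSum b F) p volume :=
  memLp_finsetSum F fun I _ => memLp_haar_smul I _ p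

lemma haarSum_eq_zero {b : ℝ → 𝕜} {F : Finset (ℤ × ℤ)} {J : ℤ × ℤ}
    (hF : ∀ I ∈ F, dyadic I ⊆ dyadic J) {x : ℝ} (hx : x ∉ dyadic J) : haarSum b F x = 0 :=
  Finset.sum_eq_zero fun I hI => by rw [haar_eq_zero fun h => hx (hF I hI h), zero_smul]

lemma integral_haarSum (b : ℝ → 𝕜) (F : Finset (ℤ × ℤ)) : ∫ x, haarSum b F x = 0 := by
  unfold haarSum
  rw [integral_finsetSum _ fun I _ => memLp_one_iff_integrable.1 (memLp_haar_smul I _ 1)]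
  refine Finset.sum_eq_zero fun I _ => ?_
  rw [integral_smul_const, integral_haar, zero_smul]

lemma mulOp_haarSum (b : ℝ → 𝕜) (F : Finset (ℤ × ℤ)) (x : ℝ) :
    mulOp b (haarSum b F) x =
      ∑ I ∈ F, (haar I x • b x) * (starRingEnd 𝕜) (haarCoeff b I) := by
  rw [mulOp, haarSum, Finset.mul_sum]
  refine Finset.sum_congr rfl fun I _ => ?_
  rw [mul_smul_comm, smul_mul_assoc]

lemma integrable_mulOp_haarSum {b : ℝ → 𝕜} (hb : LocallyIntegrable b volume)
    (F : Finset (ℤ × ℤ)) : Integrable (mulOp b (haarSum b F)) volume := by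
  rw [funext (mulOp_haarSum b F)]
  exact integrable_finsetSum _ fun I _ => (integrable_haar_smul hb I).mul_const _

lemma integral_mulOp_haarSum {b : ℝ → 𝕜} (hb : LocallyIntegrable b volume)
    (F : Finset (ℤ × ℤ)) :
    ∫ x, mulOp b (haarSum b F) x = ((∑ I ∈ F, ‖haarCoeff b I‖ ^ 2 : ℝ) : 𝕜) := by
  simp only [mulOp_haarSum]
  rw [integral_finsetSum _ fun I _ => (integrable_haar_smul hb I).mul_const _]
  push_cast
  refine Finset.sum_congr rfl fun I _ => ?_
  rw [integral_mul_const]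
  exact RCLike.mul_conj _

lemma integral_norm_haarSum_sq (b : ℝ → 𝕜) (F : Finset (ℤ × ℤ)) :
    ∫ x, ‖haarSum b F x‖ ^ 2 = ∑ I ∈ F, ‖haarCoeff b I‖ ^ 2 := by
  have e : ∀ x, ((‖haarSum b F x‖ ^ 2 : ℝ) : 𝕜) = ∑ I ∈ F, ∑ K ∈ F,
      (haar I x * haar K x) • ((starRingEnd 𝕜) (haarCoeff b I) * haarCoeff b K) := fun x => by
    rw [RCLike.ofReal_pow]
    rw [← RCLike.mul_conj, haarSum, map_sum, Finset.sum_mul_sum]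
    refine Finset.sum_congr rfl fun I _ => Finset.sum_congr rfl fun K _ => ?_
    simp only [RCLike.real_smul_eq_coe_mul, map_mul, RCLike.conj_conj, RCLike.conj_ofReal]
    ring
  have hi : ∀ I K, Integrable (fun x => (haar I x * haar K x) •
      ((starRingEnd 𝕜) (haarCoeff b I) * haarCoeff b K)) volume := fun I K =>
    (integrable_haar_mul I K).smul_const _
  have h : ((∫ x, ‖haarSum b F x‖ ^ 2 : ℝ) : 𝕜) =
      ((∑ I ∈ F, ‖haarCoeff b I‖ ^ 2 : ℝ) : 𝕜) := by
    rw [← integral_ofReal]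
    simp only [e]
    rw [integral_finsetSum _ fun I _ => integrable_finsetSum _ fun K _ => hi I K]
    push_cast
    refine Finset.sum_congr rfl fun I hI => ?_
    rw [integral_finsetSum _ fun K _ => hi I K]
    simp only [integral_smul_const, integral_haar_mul, ite_smul, one_smul, zero_smul]
    rw [Finset.sum_ite_eq, if_pos hI]
    exact RCLike.conj_mul _
  exact_mod_cast h

lemma eLpNorm_haarSum_two (b : ℝ → 𝕜) (F : Finset (ℤ × ℤ)) :
    eLpNorm (haarSum b F) 2 volume =
      ENNReal.ofReal (∑ I ∈ F, ‖haarCoeff b I‖ ^ 2) ^ (1 / 2 : ℝ) := by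
  have h2 : (2 : ℝ≥0∞) = ENNReal.ofReal 2 := by simp
  have hm := (memLp_haarSum b F 2).integrable_norm_pow (by norm_num)
  rw [h2, eLpNorm_ofReal_eq two_pos, ← integral_norm_haarSum_sq,
    ofReal_integral_eq_lintegral_ofReal (by simpa using hm)
      (Filter.Eventually.of_forall fun x => by positivity)]
  congr 2
  funext x
  rw [ENNReal.ofReal_pow (norm_nonneg _), ofReal_norm]
  norm_cast

/-! ### Test functions and the lower bound -/

lemma tsum_ofReal_rpow_lt_top {t : ℝ} (ht : 0 < t) :
    ∑' n : ℕ, ENNReal.ofReal (((2 : ℝ) ^ (n : ℤ)) ^ (-t)) < ∞ := by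
  have : ∀ n : ℕ, ((2 : ℝ) ^ (n : ℤ)) ^ (-t) = ((2 : ℝ) ^ (-t)) ^ n := fun n => by
    rw [zpow_natCast, ← Real.rpow_natCast, ← Real.rpow_natCast, ← Real.rpow_mul (by norm_num),
      ← Real.rpow_mul (by norm_num), mul_comm]
  simp only [this]
  exact (summable_geometric_of_lt_one (by positivity)
      (Real.rpow_lt_one_of_one_lt_of_neg (by norm_num) (by linarith))).tsum_ofReal_lt_top

lemma lintegral_setLIntegral_idx (k : ℤ) (G : ℝ → ℝ≥0∞) :
    ∫⁻ x, ∫⁻ y in dyadic (idx k x), G y = ENNReal.ofReal ((2 : ℝ) ^ k) * ∫⁻ y, G y := by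
  rw [lintegral_eq_tsum_level k, lintegral_eq_tsum_level k G, ← ENNReal.tsum_mul_left]
  refine tsum_congr fun j => ?_
  have : ∫⁻ x in dyadic (j, k), ∫⁻ y in dyadic (idx k x), G y =
      ∫⁻ _ in dyadic (j, k), ∫⁻ y in dyadic (j, k), G y :=
    setLIntegral_congr_fun (measurableSet_dyadic _) fun x hx => by
      have h : idx k x = (j, k) := mem_dyadic_iff.1 hx
      simp only [h]
  rw [this, setLIntegral_const, volume_dyadic, mul_comm]
  rfl

/-- Riesz potentials of integrable functions are well defined. -/
lemma rieszDefined_of_integrable {α : ℝ} (hα0 : 0 < α) (hα1 : α < 1) {g : ℝ → 𝕜}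
    (hg : Integrable g volume) : RieszDefined α g := by
  refine ⟨hg.1, ?_⟩
  have hfin : ∫⁻ y, ‖g y‖ₑ ≠ ∞ := hg.2.ne
  set a : ℤ → ℝ → ℝ≥0∞ := fun k x =>
    ENNReal.ofReal (((2 : ℝ) ^ k) ^ (-α)) * ∫⁻ y in dyadic (idx k x), ‖g y‖ₑ with ha
  have hm : ∀ k, Measurable (a k) := fun k =>
    ((measurable_of_countable fun I => ∫⁻ y in dyadic I, ‖g y‖ₑ).comp
      (measurable_idx k)).const_mul _
  -- Large scales converge at every point because α > 0.
  have h1 : ∀ x, ∑' n : ℕ, a n x < ∞ := fun x => by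
    calc ∑' n : ℕ, a n x ≤
        ∑' n : ℕ, ENNReal.ofReal (((2 : ℝ) ^ (n : ℤ)) ^ (-α)) * ∫⁻ y, ‖g y‖ₑ :=
          ENNReal.tsum_le_tsum fun n => mul_le_mul_right (setLIntegral_le_lintegral _ _) _
      _ < ∞ := by
          rw [ENNReal.tsum_mul_right]
          exact ENNReal.mul_lt_top (tsum_ofReal_rpow_lt_top hα0) (lt_top_iff_ne_top.2 hfin)
  -- Small scales converge in L¹ because α < 1: the level -n term has integral 2^(-n(1-α)) ‖g‖₁.
  have h2 : ∀ᵐ x, ∑' n : ℕ, a (-(n : ℤ)) x < ∞ := by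
    refine ae_lt_top (Measurable.tsum fun n => hm _) ?_
    rw [lintegral_tsum fun n => (hm _).aemeasurable]
    have e : ∀ n : ℕ, ∫⁻ x, a (-(n : ℤ)) x =
        ENNReal.ofReal (((2 : ℝ) ^ (n : ℤ)) ^ (-(1 - α))) * ∫⁻ y, ‖g y‖ₑ := fun n => by
      simp only [ha]
      rw [lintegral_const_mul' _ _ ENNReal.ofReal_ne_top, lintegral_setLIntegral_idx, ← mul_assoc,
        ← ENNReal.ofReal_mul (by positivity)]
      congr 2
      rw [two_zpow_rpow, two_zpow_rpow, ← Real.rpow_intCast, ← Real.rpow_add (by norm_num)]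
      congr 1; push_cast; ring
    simp only [e]
    rw [ENNReal.tsum_mul_right]
    exact ENNReal.mul_ne_top (tsum_ofReal_rpow_lt_top (by linarith)).ne hfin
  filter_upwards [h2] with x hx
  change fracSum α (fun I _ => ∫⁻ y in dyadic I, ‖g y‖ₑ) x < ∞
  rw [fracSum_eq]
  change ∑' k : ℤ, a k x < ∞
  have hs := HasSum.of_nat_of_neg_add_one (f := fun k => a k x)
    (ENNReal.summable (f := fun n : ℕ => a n x)).hasSum
    (ENNReal.summable (f := fun n : ℕ => a (-((n : ℤ) + 1)) x)).hasSum
  rw [hs.tsum_eq]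
  refine ENNReal.add_lt_top.2 ⟨h1 x, lt_of_le_of_lt ?_ hx⟩
  have := ENNReal.tsum_comp_le_tsum_of_injective (add_left_injective 1)
    (fun n : ℕ => a (-(n : ℤ)) x)
  simpa using this

lemma exists_sibling (J : ℤ × ℤ) : ∃ J' P : ℤ × ℤ, J'.2 = J.2 ∧ P.2 = J.2 + 1 ∧
    Disjoint (dyadic J) (dyadic J') ∧ dyadic J ⊆ dyadic P ∧ dyadic J' ⊆ dyadic P := by
  rcases Int.even_or_odd' J.1 with ⟨m, hm | hm⟩
  · have hJ : J = leftHalf (m, J.2 + 1) := by ext <;> simp [leftHalf, hm]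
    refine ⟨rightHalf (m, J.2 + 1), (m, J.2 + 1), by simp [rightHalf], rfl, ?_, ?_,
      dyadic_rightHalf_subset _⟩
    · conv_lhs => rw [hJ]
      exact disjoint_halves _
    · conv_lhs => rw [hJ]
      exact dyadic_leftHalf_subset _
  · have hJ : J = rightHalf (m, J.2 + 1) := by ext <;> simp [rightHalf, hm]
    refine ⟨leftHalf (m, J.2 + 1), (m, J.2 + 1), by simp [leftHalf], rfl, ?_, ?_,
      dyadic_leftHalf_subset _⟩
    · conv_lhs => rw [hJ]
      exact (disjoint_halves _).symm
    · conv_lhs => rw [hJ]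
      exact dyadic_rightHalf_subset _

/-- The value `∑_{k ≥ m} 2^(-kα)` of the kernel of `I_α` at pairs of points whose smallest common
dyadic interval has length `2^m`. -/
def kernelValue (α : ℝ) (m : ℤ) : ℝ := ∑' n : ℕ, ((2 : ℝ) ^ (m + n)) ^ (-α)

lemma summable_kernelValue {α : ℝ} (hα : 0 < α) (m : ℤ) :
    Summable fun n : ℕ => ((2 : ℝ) ^ (m + n)) ^ (-α) := by
  have h : ∀ n : ℕ, ((2 : ℝ) ^ (m + n)) ^ (-α) = ((2 : ℝ) ^ m) ^ (-α) * ((2 : ℝ) ^ (-α)) ^ n :=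
    fun n => by
      rw [two_zpow_rpow, two_zpow_rpow, ← Real.rpow_natCast, ← Real.rpow_mul (by norm_num),
        ← Real.rpow_add (by norm_num)]
      congr 1; push_cast; ring
  simp only [h]
  exact (summable_geometric_of_lt_one (by positivity)
    (Real.rpow_lt_one_of_one_lt_of_neg (by norm_num) (by linarith))).mul_left _

lemma le_kernelValue {α : ℝ} (hα : 0 < α) (m : ℤ) : ((2 : ℝ) ^ m) ^ (-α) ≤ kernelValue α m := by
  have := (summable_kernelValue hα m).le_tsum 0 fun n _ => by positivity
  simpa [kernelValue] using this

/-- Intervals through x below the parent lie in J and miss the support of g; those from the parent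
upwards contain all of it. -/
lemma riesz_of_support {α : ℝ} (hα : 0 < α) {J J' P : ℤ × ℤ} (hP : P.2 = J.2 + 1)
    (hd : Disjoint (dyadic J) (dyadic J')) (hJP : dyadic J ⊆ dyadic P)
    (hJP' : dyadic J' ⊆ dyadic P) {g : ℝ → 𝕜} (hg : ∀ x, x ∉ dyadic J' → g x = 0) {x : ℝ}
    (hx : x ∈ dyadic J) : riesz α g x = kernelValue α P.2 • ∫ y, g y := by
  rw [riesz_eq_tsum, kernelValue, ← (summable_kernelValue hα _).tsum_smul_const]
  have hinj : Function.Injective fun n : ℕ => P.2 + (n : ℤ) := fun a b h => by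
    simpa using h
  rw [← hinj.tsum_eq]
  · refine tsum_congr fun n => ?_
    have hsub : dyadic P ⊆ dyadic (idx (P.2 + n) x) :=
      dyadic_subset_of_mem (by simp) (hJP hx) (mem_dyadic_idx _ _)
    congr 1
    exact setIntegral_eq_integral_of_forall_compl_eq_zero fun y hy =>
      hg y fun h => hy (hsub (hJP' h))
  · intro k hk
    by_contra hn
    have hkP : k < P.2 := by
      by_contra h
      exact hn ⟨(k - P.2).toNat, by simp only; omega⟩
    have hsub : dyadic (idx k x) ⊆ dyadic J :=
      dyadic_subset_of_mem (by simp only [idx_snd]; omega) (mem_dyadic_idx _ _) hx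
    apply hk
    change len (idx k x) ^ (-α) • ∫ y in dyadic (idx k x), g y = 0
    rw [setIntegral_eq_zero_of_forall_eq_zero fun y hy =>
      hg y (Set.disjoint_left.1 hd (hsub hy)), smul_zero]

lemma ofReal_enorm_sum (b : ℝ → 𝕜) (F : Finset (ℤ × ℤ)) :
    ‖((∑ I ∈ F, ‖haarCoeff b I‖ ^ 2 : ℝ) : 𝕜)‖ₑ =
      ENNReal.ofReal (∑ I ∈ F, ‖haarCoeff b I‖ ^ 2) := by
  rw [← ofReal_norm, RCLike.norm_ofReal, abs_of_nonneg (Finset.sum_nonneg fun _ _ => by positivity)]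

lemma commDomain_haarSum {α p : ℝ} (hα0 : 0 < α) (hα1 : α < 1) {b : ℝ → 𝕜}
    (hb : LocallyIntegrable b volume) (F : Finset (ℤ × ℤ)) : CommDomain α p b (haarSum b F) :=
  ⟨memLp_haarSum b F _,
    rieszDefined_of_integrable hα0 hα1 (memLp_one_iff_integrable.1 (memLp_haarSum b F 1)),
    rieszDefined_of_integrable hα0 hα1 (integrable_mulOp_haarSum hb F)⟩

lemma mulOp_indicator_one (b : ℝ → 𝕜) (s : Set ℝ) :
    mulOp b (s.indicator fun _ => 1) = s.indicator b := by
  funext x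
  by_cases hx : x ∈ s <;> simp [mulOp, hx]

lemma commDomain_indicator {α p : ℝ} (hα0 : 0 < α) (hα1 : α < 1) {b : ℝ → 𝕜}
    (hb : LocallyIntegrable b volume) (J : ℤ × ℤ) :
    CommDomain α p b ((dyadic J).indicator fun _ => 1) := by
  have h : ∀ r : ℝ≥0∞, MemLp ((dyadic J).indicator fun _ => (1 : 𝕜)) r volume := fun r =>
    memLp_indicator_const r (measurableSet_dyadic J) 1 (Or.inr (volume_dyadic_ne_top J))
  refine ⟨h _, rieszDefined_of_integrable hα0 hα1 (memLp_one_iff_integrable.1 (h 1)),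
    rieszDefined_of_integrable hα0 hα1 ?_⟩
  rw [mulOp_indicator_one]
  exact (integrableOn_dyadic hb J).integrable_indicator (measurableSet_dyadic J)

/-- Testing the commutator on a dual function, for `p ≤ 2`. -/
lemma test_haarSum {α p q : ℝ} (hα0 : 0 < α) (hα1 : α < 1) (hp : 1 < p) (hq : 1 < q)
    (hp2 : p ≤ 2) {b : ℝ → 𝕜} (hb : LocallyIntegrable b volume) {C : ℝ≥0∞}
    (hC : ∀ f : ℝ → 𝕜, CommDomain α p b f →
      eLpNorm (commutator (mulOp b) (riesz α) f) (ENNReal.ofReal q) volume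
        ≤ C * eLpNorm f (ENNReal.ofReal p) volume)
    {J J' P : ℤ × ℤ} (hJ' : J'.2 = J.2) (hP : P.2 = J.2 + 1)
    (hd : Disjoint (dyadic J) (dyadic J')) (hJP : dyadic J ⊆ dyadic P)
    (hJP' : dyadic J' ⊆ dyadic P) {F : Finset (ℤ × ℤ)} (hF : ∀ I ∈ F, dyadic I ⊆ dyadic J) :
    ENNReal.ofReal (kernelValue α P.2) * ENNReal.ofReal (∑ I ∈ F, ‖haarCoeff b I‖ ^ 2) *
        ENNReal.ofReal (len J) ^ (1 / q) ≤
      C * (ENNReal.ofReal (∑ I ∈ F, ‖haarCoeff b I‖ ^ 2) ^ (1 / 2 : ℝ) *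
        ENNReal.ofReal (len J) ^ (1 / p - 1 / 2)) := by
  have hp0 : 0 < p := by linarith
  have hq0 : 0 < q := by linarith
  have hρ : 0 ≤ kernelValue α P.2 := (by positivity : (0 : ℝ) ≤ _).trans (le_kernelValue hα0 P.2)
  have hsupp : ∀ x, x ∉ dyadic J → haarSum b F x = 0 := fun x hx => haarSum_eq_zero hF hx
  set ρ := kernelValue α P.2 with hρd
  set X := ENNReal.ofReal (∑ I ∈ F, ‖haarCoeff b I‖ ^ 2) with hX
  -- Mean zero kills b I_α f on the sibling, so only I_α(bf) remains.
  have hpt : ∀ x ∈ dyadic J', ‖commutator (mulOp b) (riesz α) (haarSum b F) x‖ₑ =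
      ENNReal.ofReal ρ * X := fun x hx => by
    have r1 := riesz_of_support hα0 (hP.trans (by rw [hJ'])) hd.symm hJP' hJP hsupp hx
    have r2 := riesz_of_support hα0 (hP.trans (by rw [hJ'])) hd.symm hJP' hJP
      (g := mulOp b (haarSum b F)) (fun y hy => by rw [mulOp, hsupp y hy, mul_zero]) hx
    rw [integral_haarSum, smul_zero] at r1
    rw [integral_mulOp_haarSum hb] at r2
    rw [commutator, r2, mulOp, r1, mul_zero, zero_sub, enorm_neg, enorm_smul, ofReal_enorm_sum,
      Real.enorm_of_nonneg hρ]
  have hlow : ENNReal.ofReal ρ * X * ENNReal.ofReal (len J) ^ (1 / q) ≤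
      eLpNorm (commutator (mulOp b) (riesz α) (haarSum b F)) (ENNReal.ofReal q) volume := by
    have hl : len J = len J' := by rw [len, len, hJ']
    calc _ = (∫⁻ x in dyadic J', (ENNReal.ofReal ρ * X) ^ q) ^ (1 / q) := by
          rw [setLIntegral_const, volume_dyadic, ENNReal.mul_rpow_of_nonneg _ _ (by positivity),
            ← ENNReal.rpow_mul, mul_one_div_cancel hq0.ne', ENNReal.rpow_one, hl]
      _ = (∫⁻ x in dyadic J',
          ‖commutator (mulOp b) (riesz α) (haarSum b F) x‖ₑ ^ q) ^ (1 / q) := by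
          congr 1
          exact setLIntegral_congr_fun (measurableSet_dyadic J') fun x hx => by
            simp only [hpt x hx]
      _ ≤ _ := by
          rw [eLpNorm_ofReal_eq hq0]
          gcongr
          exact Measure.restrict_le_self
  -- Hölder on J from L² down to L^p, where p ≤ 2 enters.
  have hup : eLpNorm (haarSum b F) (ENNReal.ofReal p) volume ≤
      X ^ (1 / 2 : ℝ) * ENNReal.ofReal (len J) ^ (1 / p - 1 / 2) := by
    have hs : Function.support (haarSum b F) ⊆ dyadic J := fun x hx => by
      by_contra h; exact hx (hsupp x h)
    rw [← eLpNorm_restrict_eq_of_support_subset hs]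
    have h2 : ENNReal.ofReal p ≤ 2 := by
      rw [← ENNReal.ofReal_ofNat]; exact ENNReal.ofReal_le_ofReal hp2
    refine (eLpNorm_le_eLpNorm_mul_rpow_measure_univ h2
      (memLp_haarSum b F 1).1.restrict).trans ?_
    rw [Measure.restrict_apply_univ, volume_dyadic, ENNReal.toReal_ofReal hp0.le,
      ENNReal.toReal_ofNat, hX, ← eLpNorm_haarSum_two]
    gcongr
    exact Measure.restrict_le_self
  exact hlow.trans ((hC _ (commDomain_haarSum hα0 hα1 hb F)).trans (mul_le_mul_right hup C))

/-- Testing the commutator on an indicator function, for `2 ≤ q`. -/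
lemma test_indicator {α p q : ℝ} (hα0 : 0 < α) (hα1 : α < 1) (hp : 1 < p)
    (hq2 : 2 ≤ q) {b : ℝ → 𝕜} (hb : LocallyIntegrable b volume) {C : ℝ≥0∞}
    (hC : ∀ f : ℝ → 𝕜, CommDomain α p b f →
      eLpNorm (commutator (mulOp b) (riesz α) f) (ENNReal.ofReal q) volume
        ≤ C * eLpNorm f (ENNReal.ofReal p) volume)
    {J J' P : ℤ × ℤ} (hJ' : J'.2 = J.2) (hP : P.2 = J.2 + 1)
    (hd : Disjoint (dyadic J) (dyadic J')) (hJP : dyadic J ⊆ dyadic P)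
    (hJP' : dyadic J' ⊆ dyadic P) {F : Finset (ℤ × ℤ)} (hF : ∀ I ∈ F, dyadic I ⊆ dyadic J) :
    ENNReal.ofReal (kernelValue α P.2) * ENNReal.ofReal (∑ I ∈ F, ‖haarCoeff b I‖ ^ 2) *
        ENNReal.ofReal (len J) ^ (1 / q) ≤
      C * (ENNReal.ofReal (∑ I ∈ F, ‖haarCoeff b I‖ ^ 2) ^ (1 / 2 : ℝ) *
        ENNReal.ofReal (len J) ^ (1 / p - 1 / 2)) := by
  have hp0 : 0 < p := by linarith
  have hq0 : 0 < q := by linarith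
  have hl : len J' = len J := by rw [len, len, hJ']
  have hρ : 0 ≤ kernelValue α P.2 := (by positivity : (0 : ℝ) ≤ _).trans (le_kernelValue hα0 P.2)
  have hsupp : ∀ x, x ∉ dyadic J → haarSum b F x = 0 := fun x hx => haarSum_eq_zero hF hx
  set ρ := kernelValue α P.2 with hρd
  set X := ENNReal.ofReal (∑ I ∈ F, ‖haarCoeff b I‖ ^ 2) with hX
  set ℓ := ENNReal.ofReal (len J) with hℓ
  have hℓ0 : ℓ ≠ 0 := ofReal_len_ne_zero J
  have hℓt : ℓ ≠ ∞ := ENNReal.ofReal_ne_top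
  set c := avg b J' with hc
  set u : ℝ → 𝕜 := fun x => b x - c with hu
  have hum : AEStronglyMeasurable u volume := hb.aestronglyMeasurable.sub aestronglyMeasurable_const
  have hpt : ∀ x ∈ dyadic J,
      ‖commutator (mulOp b) (riesz α) ((dyadic J').indicator fun _ => 1) x‖ₑ =
        ENNReal.ofReal ρ * ℓ * ‖u x‖ₑ := fun x hx => by
    have r1 := riesz_of_support hα0 hP hd hJP hJP' (g := (dyadic J').indicator fun _ => (1 : 𝕜))
      (fun y hy => Set.indicator_of_notMem hy _) hx
    have r2 := riesz_of_support hα0 hP hd hJP hJP' (g := (dyadic J').indicator b)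
      (fun y hy => Set.indicator_of_notMem hy _) hx
    rw [integral_indicator (measurableSet_dyadic J'), setIntegral_const, volume_real_dyadic,
      hl] at r1
    rw [integral_indicator (measurableSet_dyadic J'), ← len_smul_avg, hl] at r2
    have e : commutator (mulOp b) (riesz α) ((dyadic J').indicator fun _ => 1) x =
        (ρ * len J) • u x := by
      rw [commutator, mulOp_indicator_one, mulOp, r1, r2]
      simp only [hu, RCLike.real_smul_eq_coe_mul, RCLike.ofReal_mul]
      ring
    rw [e, enorm_smul, Real.enorm_of_nonneg (mul_nonneg hρ (len_pos J).le),
      ENNReal.ofReal_mul hρ]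
  have hlow : ENNReal.ofReal ρ * ℓ * eLpNorm u (ENNReal.ofReal q) (volume.restrict (dyadic J)) ≤
      C * ℓ ^ (1 / p) := by
    calc _ = (∫⁻ x in dyadic J, (ENNReal.ofReal ρ * ℓ * ‖u x‖ₑ) ^ q) ^ (1 / q) := by
          simp only [ENNReal.mul_rpow_of_nonneg (ENNReal.ofReal ρ * ℓ) _ hq0.le]
          rw [eLpNorm_ofReal_eq hq0, lintegral_const_mul' _ _ (ENNReal.rpow_ne_top_of_nonneg hq0.le
            (ENNReal.mul_ne_top ENNReal.ofReal_ne_top hℓt)),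
            ENNReal.mul_rpow_of_nonneg _ _ (by positivity), ← ENNReal.rpow_mul,
            mul_one_div_cancel hq0.ne', ENNReal.rpow_one]
      _ = (∫⁻ x in dyadic J, ‖commutator (mulOp b) (riesz α)
          ((dyadic J').indicator fun _ => 1) x‖ₑ ^ q) ^ (1 / q) := by
          congr 1
          exact setLIntegral_congr_fun (measurableSet_dyadic J) fun x hx => by
            simp only [hpt x hx]
      _ ≤ eLpNorm (commutator (mulOp b) (riesz α) ((dyadic J').indicator fun _ => 1))
          (ENNReal.ofReal q) volume := by
          rw [eLpNorm_ofReal_eq hq0]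
          gcongr
          exact Measure.restrict_le_self
      _ ≤ _ := hC _ (commDomain_indicator hα0 hα1 hb J')
      _ = _ := by
          rw [eLpNorm_indicator_const (measurableSet_dyadic J') (by simpa using hp0)
            ENNReal.ofReal_ne_top, volume_dyadic, hl, ENNReal.toReal_ofReal hp0.le, enorm_one,
            one_mul]
  -- The dual function has mean zero, so subtracting c from b does not change the pairing;
  -- Cauchy–Schwarz on J follows.
  have hpair : X ≤ eLpNorm u 2 (volume.restrict (dyadic J)) * X ^ (1 / 2 : ℝ) := by
    have hi : ∫ x, u x * haarSum b F x = ((∑ I ∈ F, ‖haarCoeff b I‖ ^ 2 : ℝ) : 𝕜) := by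
      have i1 := integrable_mulOp_haarSum hb F
      have i2 : Integrable (fun x => c * haarSum b F x) volume :=
        (memLp_one_iff_integrable.1 (memLp_haarSum b F 1)).const_mul c
      calc _ = ∫ x, (mulOp b (haarSum b F) x - c * haarSum b F x) := by
            simp only [hu, mulOp, sub_mul]
        _ = _ := by
            rw [integral_sub i1 i2, integral_mulOp_haarSum hb, integral_const_mul,
              integral_haarSum, mul_zero, sub_zero]
    have h2 : (2 : ℝ≥0∞) = ENNReal.ofReal 2 := by simp
    calc X = ‖∫ x, u x * haarSum b F x‖ₑ := by rw [hi, ofReal_enorm_sum]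
      _ = ‖∫ x in dyadic J, u x * haarSum b F x‖ₑ := by
          rw [setIntegral_eq_integral_of_forall_compl_eq_zero fun x hx => by
            rw [hsupp x hx, mul_zero]]
      _ ≤ ∫⁻ x in dyadic J, ‖u x‖ₑ * ‖haarSum b F x‖ₑ := by
          simp only [← enorm_mul]
          exact enorm_integral_le_lintegral_enorm _
      _ ≤ _ := ENNReal.lintegral_mul_le_Lp_mul_Lq _ Real.HolderConjugate.two_two
          hum.restrict.enorm (memLp_haarSum b F 1).1.restrict.enorm
      _ ≤ _ := by
          rw [h2, ← eLpNorm_ofReal_eq two_pos, ← eLpNorm_ofReal_eq two_pos, hX,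
            ← eLpNorm_haarSum_two, h2]
          gcongr
          exact Measure.restrict_le_self
  have hqn : eLpNorm u 2 (volume.restrict (dyadic J)) ≤
      eLpNorm u (ENNReal.ofReal q) (volume.restrict (dyadic J)) * ℓ ^ (1 / 2 - 1 / q) := by
    have h2 : 2 ≤ ENNReal.ofReal q := by
      rw [← ENNReal.ofReal_ofNat]; exact ENNReal.ofReal_le_ofReal hq2
    have := eLpNorm_le_eLpNorm_mul_rpow_measure_univ h2 hum.restrict (μ := volume.restrict (dyadic J))
    rwa [Measure.restrict_apply_univ, volume_dyadic, ENNReal.toReal_ofReal hq0.le,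
      ENNReal.toReal_ofNat] at this
  have e1 : ℓ ^ (1 / 2 - 1 / q) * ℓ ^ (1 / q) = ℓ * ℓ ^ (-(1 / 2) : ℝ) := by
    conv_rhs => rw [← ENNReal.rpow_one ℓ, ← ENNReal.rpow_mul, one_mul]
    rw [← ENNReal.rpow_add _ _ hℓ0 hℓt, ← ENNReal.rpow_add _ _ hℓ0 hℓt]
    congr 1; ring
  calc ENNReal.ofReal ρ * X * ℓ ^ (1 / q) ≤ ENNReal.ofReal ρ *
        ((eLpNorm u (ENNReal.ofReal q) (volume.restrict (dyadic J)) * ℓ ^ (1 / 2 - 1 / q)) *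
          X ^ (1 / 2 : ℝ)) * ℓ ^ (1 / q) := by
        gcongr
        exact hpair.trans (by gcongr)
    _ = ENNReal.ofReal ρ * eLpNorm u (ENNReal.ofReal q) (volume.restrict (dyadic J)) *
        X ^ (1 / 2 : ℝ) * (ℓ ^ (1 / 2 - 1 / q) * ℓ ^ (1 / q)) := by ring
    _ = (ENNReal.ofReal ρ * ℓ * eLpNorm u (ENNReal.ofReal q) (volume.restrict (dyadic J))) *
        (X ^ (1 / 2 : ℝ) * ℓ ^ (-(1 / 2) : ℝ)) := by rw [e1]; ring
    _ ≤ (C * ℓ ^ (1 / p)) * (X ^ (1 / 2 : ℝ) * ℓ ^ (-(1 / 2) : ℝ)) := by gcongr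
    _ = C * (X ^ (1 / 2 : ℝ) * (ℓ ^ (1 / p) * ℓ ^ (-(1 / 2) : ℝ))) := by ring
    _ = _ := by rw [← ENNReal.rpow_add _ _ hℓ0 hℓt, sub_eq_add_neg]

/-- Both test functions yield the same inequality, with the sum X on the left and X^(1/2) on the
right. Finiteness of F makes X finite, so X^(1/2) can be cancelled. -/
lemma sum_sq_haarCoeff_le {α p q : ℝ} (hα0 : 0 < α) (hα1 : α < 1) (hp : 1 < p) (hpq : p < q)
    (hαpq : 1 - α + 1 / q = 1 / p) {b : ℝ → 𝕜} (hb : LocallyIntegrable b volume) {C : ℝ≥0∞}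
    (hC : ∀ f : ℝ → 𝕜, CommDomain α p b f →
      eLpNorm (commutator (mulOp b) (riesz α) f) (ENNReal.ofReal q) volume
        ≤ C * eLpNorm f (ENNReal.ofReal p) volume)
    (J : ℤ × ℤ) {F : Finset (ℤ × ℤ)} (hF : ∀ I ∈ F, dyadic I ⊆ dyadic J) :
    ENNReal.ofReal (∑ I ∈ F, ‖haarCoeff b I‖ ^ 2) ≤ (2 * C) ^ 2 * ENNReal.ofReal (len J) := by
  obtain ⟨J', P, hJ', hP, hd, hJP, hJP'⟩ := exists_sibling J
  have key : ENNReal.ofReal (kernelValue α P.2) *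
      ENNReal.ofReal (∑ I ∈ F, ‖haarCoeff b I‖ ^ 2) * ENNReal.ofReal (len J) ^ (1 / q) ≤
      C * (ENNReal.ofReal (∑ I ∈ F, ‖haarCoeff b I‖ ^ 2) ^ (1 / 2 : ℝ) *
        ENNReal.ofReal (len J) ^ (1 / p - 1 / 2)) := by
    rcases le_total 2 q with h2 | h2
    · exact test_indicator hα0 hα1 hp h2 hb hC hJ' hP hd hJP hJP' hF
    · exact test_haarSum hα0 hα1 hp (hp.trans hpq) (hpq.le.trans h2) hb hC hJ' hP hd hJP hJP' hF
  have hl := len_pos J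
  -- The parent has length 2|J|, and 2^(-α) ≥ 1/2; this is the only loss in the lower bound.
  have hρ : ENNReal.ofReal (len J) ^ (-α) ≤ 2 * ENNReal.ofReal (kernelValue α P.2) := by
    rw [ENNReal.ofReal_rpow_of_pos hl, ← ENNReal.ofReal_ofNat, ← ENNReal.ofReal_mul (by norm_num)]
    apply ENNReal.ofReal_le_ofReal
    have h1 := le_kernelValue hα0 P.2
    have h2 : (2 : ℝ) ^ P.2 = 2 * len J := by
      rw [hP, zpow_add_one₀ (by norm_num), mul_comm]; rfl
    rw [h2, Real.mul_rpow (by norm_num) hl.le] at h1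
    have h3 : (2 : ℝ)⁻¹ ≤ (2 : ℝ) ^ (-α) := by
      rw [← Real.rpow_neg_one]
      exact Real.rpow_le_rpow_of_exponent_le (by norm_num) (by linarith)
    have h4 := Real.rpow_pos_of_pos hl (-α)
    nlinarith
  set X := ENNReal.ofReal (∑ I ∈ F, ‖haarCoeff b I‖ ^ 2) with hX
  set ℓ := ENNReal.ofReal (len J) with hℓ
  have hℓ0 : ℓ ≠ 0 := ofReal_len_ne_zero J
  have hℓt : ℓ ≠ ∞ := ENNReal.ofReal_ne_top
  have hXt : X ≠ ∞ := ENNReal.ofReal_ne_top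
  rcases eq_or_ne X 0 with h0 | h0
  · rw [h0]; exact zero_le
  have hsq : X ^ (1 / 2 : ℝ) * X ^ (1 / 2 : ℝ) = X := by
    rw [← ENNReal.rpow_add _ _ h0 hXt]; norm_num
  set Y := X ^ (1 / 2 : ℝ) with hY
  have hY0 : Y ≠ 0 := fun h => h0 (by rw [← hsq, h, mul_zero])
  have hYt : Y ≠ ∞ := ENNReal.rpow_ne_top_of_nonneg (by norm_num) hXt
  have h1 : ℓ ^ (1 / q - α) * Y ≤ 2 * C * ℓ ^ (1 / p - 1 / 2) := by
    rw [← ENNReal.mul_le_mul_iff_left hY0 hYt]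
    calc ℓ ^ (1 / q - α) * Y * Y = ℓ ^ (-α) * (X * ℓ ^ (1 / q)) := by
          rw [mul_assoc, hsq, sub_eq_add_neg, ENNReal.rpow_add _ _ hℓ0 hℓt]; ring
      _ ≤ 2 * ENNReal.ofReal (kernelValue α P.2) * (X * ℓ ^ (1 / q)) := by gcongr
      _ = 2 * (ENNReal.ofReal (kernelValue α P.2) * X * ℓ ^ (1 / q)) := by ring
      _ ≤ 2 * (C * (Y * ℓ ^ (1 / p - 1 / 2))) := by gcongr
      _ = _ := by ring
  have h2 : Y ≤ 2 * C * ℓ ^ (1 / 2 : ℝ) := by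
    calc Y = ℓ ^ (α - 1 / q) * (ℓ ^ (1 / q - α) * Y) := by
          rw [← mul_assoc, ← ENNReal.rpow_add _ _ hℓ0 hℓt]; simp
      _ ≤ ℓ ^ (α - 1 / q) * (2 * C * ℓ ^ (1 / p - 1 / 2)) := by gcongr
      _ = 2 * C * (ℓ ^ (α - 1 / q) * ℓ ^ (1 / p - 1 / 2)) := by ring
      _ = _ := by
          rw [← ENNReal.rpow_add _ _ hℓ0 hℓt]
          -- The scaling relation gives α - 1/q + 1/p = 1, which leaves the exponent 1/2.
          congr 2; linarith
  calc X = Y * Y := hsq.symm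
    _ ≤ (2 * C * ℓ ^ (1 / 2 : ℝ)) * (2 * C * ℓ ^ (1 / 2 : ℝ)) := mul_le_mul' h2 h2
    _ = (2 * C) ^ 2 * (ℓ ^ (1 / 2 : ℝ) * ℓ ^ (1 / 2 : ℝ)) := by ring
    _ = _ := by rw [← ENNReal.rpow_add _ _ hℓ0 hℓt]; norm_num

/-- The lower bound for the commutator. -/
theorem bmoNorm_le_of_commutator_bound {α p q : ℝ} (hα0 : 0 < α) (hα1 : α < 1) (hp : 1 < p)
    (hpq : p < q) (hαpq : 1 - α + 1 / q = 1 / p) {b : ℝ → 𝕜} (hb : LocallyIntegrable b volume)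
    {C : ℝ≥0∞} (hC : ∀ f : ℝ → 𝕜, CommDomain α p b f →
      eLpNorm (commutator (mulOp b) (riesz α) f) (ENNReal.ofReal q) volume
        ≤ C * eLpNorm f (ENNReal.ofReal p) volume) : bmoNorm b ≤ 2 * C := by
  refine iSup_le fun J => ?_
  have h : carlesonSum b J ≤ (2 * C) ^ 2 * ENNReal.ofReal (len J) := by
    rw [carlesonSum, ENNReal.tsum_eq_iSup_sum]
    refine iSup_le fun s => ?_
    have hs := sum_sq_haarCoeff_le hα0 hα1 hp hpq hαpq hb hC J
      (F := s.map (Function.Embedding.subtype _)) (fun I hI => by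
        obtain ⟨K, -, rfl⟩ := Finset.mem_map.1 hI
        exact K.2)
    rw [Finset.sum_map, ENNReal.ofReal_sum_of_nonneg fun _ _ => by positivity] at hs
    simpa only [Function.Embedding.subtype_apply, ENNReal.ofReal_pow (norm_nonneg _),
      ofReal_norm] using hs
  calc _ ≤ ((ENNReal.ofReal (len J))⁻¹ * ((2 * C) ^ 2 * ENNReal.ofReal (len J))) ^ (1 / 2 : ℝ) := by
        gcongr; exact h
    _ = 2 * C := by
        rw [mul_left_comm, ENNReal.inv_mul_cancel (ofReal_len_ne_zero J) ENNReal.ofReal_ne_top,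
          mul_one, ← ENNReal.rpow_natCast, ← ENNReal.rpow_mul]
        norm_num

end DyadicChanillo

end

/-! ### The two-sided estimate. -/

theorem theorem2p2 {𝕜 : Type*} [RCLike 𝕜] (α p q : ℝ) (hα0 : 0 < α) (hα1 : α < 1)
    (hp : 1 < p) (hpq : p < q) (hαpq : 1 - α + 1 / q = 1 / p) :
    ∃ c C : ℝ≥0, 0 < c ∧ 0 < C ∧ ∀ b : ℝ → 𝕜, LocallyIntegrable b volume →
      (c : ℝ≥0∞) * DyadicChanillo.bmoNorm b ≤ DyadicChanillo.commNorm α p q b ∧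
      DyadicChanillo.commNorm α p q b ≤ (C : ℝ≥0∞) * DyadicChanillo.bmoNorm b ∧
      (DyadicChanillo.bmoNorm b < ∞ → ∀ f : ℝ → 𝕜, MemLp f (ENNReal.ofReal p) volume →
        DyadicChanillo.CommDomain α p b f) := by
  obtain ⟨C, hC0, hC⟩ := DyadicChanillo.commutator_upper_bound (𝕜 := 𝕜) hp hpq hαpq
  refine ⟨2⁻¹, C, by positivity, hC0, fun b hb => ⟨?_, ?_, fun hfin f hf => ?_⟩⟩
  · refine le_sInf fun D hD => ?_
    have h := DyadicChanillo.bmoNorm_le_of_commutator_bound hα0 hα1 hp hpq hαpq hb hD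
    calc _ ≤ ((2⁻¹ : ℝ≥0) : ℝ≥0∞) * (2 * D) := by gcongr
      _ = D := by
        rw [← mul_assoc, ENNReal.coe_inv two_ne_zero, ENNReal.coe_ofNat,
          ENNReal.inv_mul_cancel (by simp) (by simp), one_mul]
  · have key : ∀ B : ℝ≥0, 0 < B → DyadicChanillo.bmoNorm b ≤ B →
        DyadicChanillo.commNorm α p q b ≤ C * B := fun B hB hb' => by
      refine sInf_le fun f hf => ?_
      have := (hC b hb B hB (by simpa using hb') f hf.1).2
      rwa [ENNReal.ofReal_coe_nnreal] at this
    -- The upper bound requires B > 0, so the BMO norm is enlarged by ε/C; this also covers seminorm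
    -- zero.
    refine ENNReal.le_of_forall_pos_le_add fun ε hε hlt => ?_
    have hfin : DyadicChanillo.bmoNorm b ≠ ∞ := fun h => by
      rw [h, ENNReal.mul_top (by simpa using hC0.ne')] at hlt
      exact lt_irrefl _ hlt
    have h := key ((DyadicChanillo.bmoNorm b).toNNReal + ε / C) (by positivity) (by
      rw [ENNReal.coe_add, ENNReal.coe_toNNReal hfin]
      exact le_self_add)
    refine h.trans (le_of_eq ?_)
    rw [ENNReal.coe_add, ENNReal.coe_toNNReal hfin, mul_add, ← ENNReal.coe_mul,
      mul_div_cancel₀ _ hC0.ne']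
  · refine (hC b hb ((DyadicChanillo.bmoNorm b).toReal + 1) (by positivity) ?_ f hf).1
    rw [ENNReal.ofReal_add (by positivity) zero_le_one, ENNReal.ofReal_toReal hfin.ne]
    exact le_self_add
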